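/- Let $\Theta\subseteq\mathbb R^d$ be open and convex, let $x_1,\dots,x_N\in\mathcal X$ ($N\ge1$), let $t>0$, and let $f:\mathcal X\times\Theta\to[F_{\min},F_{\max}]$ be $L$-Lipschitz in $\theta$, i.e. $|f(x;\theta)-f(x;\theta')|\le L\|\theta-\theta'\|$ for all $x\in\mathcal X$ and $\theta,\theta'\in\Theta$, with each $f(x_i;\cdot)$ continuously differentiable on $\Theta$. Let $$\widetilde R(t;\theta)=\frac1t\log\Big(\frac1N\sum_{i=1}^N e^{tf(x_i;\theta)}\Big).$$ Assume that $\widetilde R(t;\cdot)$ is $\mu$-strongly convex on $\Theta$ with $\mu>0$, let $\theta^*\in\arg\min_{\theta\in\Theta}\widetilde R(t;\theta)$, and assume that $$\Big\|\frac{e^{tf(x_i;\theta)}}{e^{t\widetilde R(t;\theta)}}\nabla_\theta f(x_i;\theta)\Big\|\le B\qquad\text{for all } i\in[N],\ \theta\in\Theta .$$ Let $k_t$ be the largest integer $k\ge1$ with $$k<\frac{2e}{\mu}+\frac{e\,tLB\,e^{t(F_{\max}-F_{\min})}}{\mu k}$$ ($k_t=1$ if there is none). Put $\lambda=1-\frac1{2e}$,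 $\alpha_k=\frac1{1+tLBe^{t(F_{\max}-F_{\min})}}$ for $1\le k<k_t$, and $\alpha_k=\frac{2e}{\mu k}$ for $k\ge k_t$. Consider the two-minibatch stochastic TERM solver with batch size $1$. Let $\theta_1$ be a (possibly random) initial point and let $\zeta_1,\xi_1,\zeta_2,\xi_2,\dots$ be mutually independent and uniform on $[N]$, and independent of $\theta_1$. Start from $\widehat R_0=\widetilde R(t;\theta_1)$, and for $k=1,2,\dots$ set $$\widehat R_k=\frac1t\log\Big((1-\lambda)e^{t\widehat R_{k-1}}+\lambda e^{tf(x_{\xi_k};\theta_k)}\Big),\qquad \theta_{k+1}=\theta_k-\alpha_k\,e^{tf(x_{\zeta_k};\theta_k)-t\widehat R_k}\,\nabla_\theta f(x_{\zeta_k};\theta_k).$$ Assume that almost surely all the iterates $\theta_k$, $k\ge1$, lie in $\Theta$. Then $\mathbb E\|\theta_k-\theta^*\|^2<\infty$ for every $k\ge1$, and for all $k\ge k_t$ $$\mathbb E\big[\|\theta_{k+1}-\theta^*\|^2\big]\le\frac{V_t}{k+1},\qquad V_t=\max\Big\{k_t\,\mathbb E\big[\|\theta_{k_t}-\theta^*\|^2\big],\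 \frac{4B^2e^{2+2t(F_{\max}-F_{\min})}}{\mu^2}\Big\},$$ and moreover $$\mathbb E\big[\|\theta_{k_t}-\theta^*\|^2\big]\le\max\Big\{\mathbb E\big[\|\theta_1-\theta^*\|^2\big],\ \frac{B^2e^{2t(F_{\max}-F_{\min})+1}}{\mu\big(1+tLBe^{t(F_{\max}-F_{\min})}\big)}\Big\}.$$ -/

import Mathlib

open MeasureTheory ProbabilityTheory

noncomputable section

namespace TERM

variable {𝒳 : Type*} {d N : ℕ}

/-- The `t`-tilted loss on the subsample `S ⊆ [N]`:
`(1/t) log ((1/|S|) ∑_{i ∈ S} exp (t f(x_i; θ)))`. -/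
def tiltedLossOn (f : 𝒳 → EuclideanSpace ℝ (Fin d) → ℝ) (x : Fin N → 𝒳) (t : ℝ)
    (S : Finset (Fin N)) (θ : EuclideanSpace ℝ (Fin d)) : ℝ :=
  (1 / t) * Real.log ((1 / (S.card : ℝ)) * ∑ i ∈ S, Real.exp (t * f (x i) θ))

/-- The `t`-tilted loss `R̃(t; θ)` on all the data. -/
def tiltedLoss (f : 𝒳 → EuclideanSpace ℝ (Fin d) → ℝ) (x : Fin N → 𝒳) (t : ℝ)
    (θ : EuclideanSpace ℝ (Fin d)) : ℝ :=
  tiltedLossOn f x t Finset.univ θ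

/-- The stochastic gradient `∇R̃(x_i; θ) = (e^{t f(x_i; θ)} / e^{t R̃(t; θ)}) ∇f(x_i; θ)`. -/
def tiltedStochGrad (f : 𝒳 → EuclideanSpace ℝ (Fin d) → ℝ) (x : Fin N → 𝒳) (t : ℝ)
    (i : Fin N) (θ : EuclideanSpace ℝ (Fin d)) : EuclideanSpace ℝ (Fin d) :=
  (Real.exp (t * f (x i) θ) / Real.exp (t * tiltedLoss f x t θ)) • gradient (f (x i)) θ

/-- Tilted averaging of the current normalizer estimate `R` with the `t`-tilted loss on the
minibatch `B₂` at the current parameter `θ`. -/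
def updateNormalizer (f : 𝒳 → EuclideanSpace ℝ (Fin d) → ℝ) (x : Fin N → 𝒳) (t lam : ℝ)
    (B₂ : Finset (Fin N)) (θ : EuclideanSpace ℝ (Fin d)) (R : ℝ) : ℝ :=
  (1 / t) * Real.log ((1 - lam) * Real.exp (t * R)
    + lam * Real.exp (t * tiltedLossOn f x t B₂ θ))

/-- Gradient step on the minibatch `B₁` with weights `e^{t f(x_i; θ) - t R}`. -/
def updateParam (f : 𝒳 → EuclideanSpace ℝ (Fin d) → ℝ) (x : Fin N → 𝒳) (t α : ℝ)
    (B₁ : Finset (Fin N)) (θ : EuclideanSpace ℝ (Fin d)) (R : ℝ) : EuclideanSpace ℝ (Fin d) :=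
  θ - (α / (B₁.card : ℝ)) •
    ∑ i ∈ B₁, Real.exp (t * f (x i) θ - t * R) • gradient (f (x i)) θ

/-- The pair (parameter, normalizer estimate) after `n` iterations of the stochastic solver with
two minibatches. Iterations are numbered `1, 2, …`; iteration `k` uses the step size `α k`, the
minibatch `B₁ k` for the gradients and `B₂ k` for the normalizer, and the gradient step uses the
freshly updated normalizer. -/
def solverState (f : 𝒳 → EuclideanSpace ℝ (Fin d) → ℝ) (x : Fin N → 𝒳) (t lam : ℝ)
    (α : ℕ → ℝ) (B₁ B₂ : ℕ → Finset (Fin N)) (θ₁ : EuclideanSpace ℝ (Fin d)) :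
    ℕ → EuclideanSpace ℝ (Fin d) × ℝ
  | 0 => (θ₁, tiltedLoss f x t θ₁)
  | n + 1 =>
    let s := solverState f x t lam α B₁ B₂ θ₁ n
    let R := updateNormalizer f x t lam (B₂ (n + 1)) s.1 s.2
    (updateParam f x t (α (n + 1)) (B₁ (n + 1)) s.1 R, R)

/-- The iterate `θ_k`, `k ≥ 1`: the parameter at the start of iteration `k`. -/
def solverIterate (f : 𝒳 → EuclideanSpace ℝ (Fin d) → ℝ) (x : Fin N → 𝒳) (t lam : ℝ)
    (α : ℕ → ℝ) (B₁ B₂ : ℕ → Finset (Fin N)) (θ₁ : EuclideanSpace ℝ (Fin d)) (k : ℕ) :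
    EuclideanSpace ℝ (Fin d) :=
  (solverState f x t lam α B₁ B₂ θ₁ (k - 1)).1

/-- The burn-in `k_t`: the largest integer `k ≥ 1` with
`k < 2e/μ + e t L B e^{t (Fmax - Fmin)} / (μ k)`, and `1` if there is none. -/
def burnIn (t L B μ Fmin Fmax : ℝ) : ℕ :=
  max 1 (sSup {k : ℕ | 1 ≤ k ∧ (k : ℝ) < 2 * Real.exp 1 / μ
    + Real.exp 1 * t * L * B * Real.exp (t * (Fmax - Fmin)) / (μ * k)})

/-- The step sizes: constant during the burn-in, `2e/(μ k)` from then on. -/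
def stepSize (t L B μ Fmin Fmax : ℝ) (k : ℕ) : ℝ :=
  if k < burnIn t L B μ Fmin Fmax then
    1 / (t * L * B * Real.exp (t * (Fmax - Fmin)) + 1)
  else 2 * Real.exp 1 / (μ * k)

/-- The averaging parameter `λ = 1 - 1/(2e)`. -/
def avgParam : ℝ := 1 - 1 / (2 * Real.exp 1)

/-- `θ_k` for the above step sizes and averaging parameter and minibatches of size one: at
iteration `k` the gradient is taken at the sample `ζ k`, the normalizer is updated with `ξ k`. -/
def termIterate (f : 𝒳 → EuclideanSpace ℝ (Fin d) → ℝ) (x : Fin N → 𝒳)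
    (t L B μ Fmin Fmax : ℝ) (ζ ξ : ℕ → Fin N) (θ₁ : EuclideanSpace ℝ (Fin d)) (k : ℕ) :
    EuclideanSpace ℝ (Fin d) :=
  solverIterate f x t avgParam (stepSize t L B μ Fmin Fmax)
    (fun k => {ζ k}) (fun k => {ξ k}) θ₁ k

end TERM

end

namespace TERM

/-! Let d_n be the distance from the n-th iterate to the minimizer, a_n = e^{tR̃} the exact
normalizer there, v_n the estimate by which the step divides, s = e^{t(Fmax-Fmin)} and D_n = E d_n².
The gradient sample is independent of v_n, so averaging over it and using strong convexity gives
D_{n+1} ≤ D_n - 2αμ E[d_n² a_n/v_n] + (αBs)².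

The danger is an estimate v_n that is too large: the pointwise bound a_n/v_n ≥ 1/s would cost a
factor s in the rate. Instead, with κ = 1/(2e), the inequality a/v ≥ 2κ - κ² v/a reduces everything
to P_n = E[d_n² v_n/a_n] ≤ 2e D_n, after which D contracts by 1 - αμ/e. The quantity P_n is linear
in v_n, so averaging over the normalizer sample is exact: the stale part of the estimate is
multiplied by κ and the fresh part contributes (1-κ) D_n. Since log a is tB-Lipschitz, steps of
length δ with tBδ ≤ 1/4 barely disturb the ratio, and P_n/D_n falls geometrically to about 2, up to
a term of order sδ² (`weight_le_of_window`).

It remains to make δ small. Strong convexity confines Θ: D_n ≤ B²/μ² and D_n ≤ 2(Fmax-Fmin)/μ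
always. If the claimed bound exceeds one of these, it is trivial. Otherwise the first makes the step
small against 1/s² and the second, as log s is small against s, yields tBδ ≤ 1/4. If D_n is below
half of the claimed bound, one step without contraction does no harm; if it is above, D_n dominates
the noise and P_n ≤ 2e D_n follows. For s ≤ 5 < 2e the bound on P_n is immediate. -/

/-- Recursive bounds linking the mean squared distance `D n` to the minimizer and the mean `P n` of
the squared distance weighted by the ratio of the estimated to the exact normalizer, for step
sizes `α n`, gradient bound `B`, convexity modulus `μ` and loss range `Δ`. -/
structure DescentBounds (D P α : ℕ → ℝ) (t B μ Δ : ℝ) : Prop where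
  pos_t : 0 < t
  pos_mu : 0 < μ
  nonneg_B : 0 ≤ B
  nonneg_D : ∀ n, 0 ≤ D n
  le_sq_div : ∀ n, D n ≤ B ^ 2 / μ ^ 2
  le_range_div : ∀ n, D n ≤ 2 * Δ / μ
  contract : ∀ n, P n ≤ 2 * Real.exp 1 * D n →
    D (n + 1) ≤ (1 - α n * μ / Real.exp 1) * D n + (α n * B * Real.exp (t * Δ)) ^ 2
  growth : ∀ n, D (n + 1) ≤ D n + (α n * B * Real.exp (t * Δ)) ^ 2
  weight_le : ∀ n, P n ≤ Real.exp (t * Δ) * D n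
  weight_zero : P 0 ≤ D 0
  nonneg_P : ∀ n, 0 ≤ P n
  weight_succ : ∀ n δ, α n * B * Real.exp (t * Δ) ≤ δ → t * B * δ ≤ 1 / 4 →
    P (n + 1) ≤ 1 / (2 * Real.exp 1) *
      (4 / 3 * (5 / 4 * P n + 5 * Real.exp (t * Δ) * δ ^ 2)) + D (n + 1)
  le_succ : ∀ n δ, α n * B * Real.exp (t * Δ) ≤ δ → D n ≤ 5 / 4 * D (n + 1) + 5 * δ ^ 2

/-- Makes the linear bound `2 * Δ / μ` usable: it turns `t * Δ` into a small multiple of `exp (t *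
Δ)`, which is how `t * B * δ ≤ 1 / 4` is obtained later. The constant 0.245 leaves room below 1/4
for replacing `k + 1` by `k`. -/
theorem two_mul_div_exp_one_le {l : ℝ} (hl : 5 ≤ Real.exp l) :
    2 * l ≤ 0.245 * Real.exp 1 * Real.exp l := by
  have h1 : l / 2 ≤ Real.exp (l / 2 - 1) := by
    have := Real.add_one_le_exp (l / 2 - 1); linarith
  rw [Real.exp_sub] at h1
  have he := Real.exp_one_gt_d9
  set e := Real.exp 1
  set y := Real.exp (l / 2) with hy
  have hs : Real.exp l = y ^ 2 := by rw [hy, ← Real.exp_nat_mul]; congr 1; push_cast; ring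
  have hy0 : 0 < y := Real.exp_pos _
  rw [hs] at hl ⊢
  have hy2 : 2.23 ≤ y := by nlinarith
  rw [le_div_iff₀ (by linarith)] at h1
  have h2 : 2 * l * e ≤ 4 * y := by linarith
  have h3 : 4 * y ≤ 0.245 * e * y ^ 2 * e := by
    have : 7.38 ≤ e ^ 2 := by nlinarith
    nlinarith [mul_le_mul this (mul_le_mul_of_nonneg_left hy2 hy0.le) (by positivity)
      (by positivity)]
  exact le_of_mul_le_mul_right (h2.trans h3) (by linarith)

/-! ### Deterministic analysis of the recursive bounds. -/

section Recursion

variable {D P α : ℕ → ℝ} {t B μ Δ : ℝ}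

theorem one_div_two_exp_one_le : 1 / (2 * Real.exp 1) ≤ 0.19 := by
  have he := Real.exp_one_gt_d9
  rw [div_le_iff₀ (by positivity)]; linarith

theorem DescentBounds.one_le_exp (h : DescentBounds D P α t B μ Δ) : 1 ≤ Real.exp (t * Δ) := by
  have h₁ : 0 ≤ 2 * Δ / μ := (h.nonneg_D 0).trans (h.le_range_div 0)
  have h₂ : 0 ≤ Δ := by
    by_contra hΔ
    have : 2 * Δ / μ < 0 := div_neg_of_neg_of_pos (by linarith) h.pos_mu
    linarith
  exact Real.one_le_exp (mul_nonneg h.pos_t.le h₂)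

theorem DescentBounds.weight_le_of_exp_le (h : DescentBounds D P α t B μ Δ)
    (hs : Real.exp (t * Δ) ≤ 5) (n : ℕ) : P n ≤ 2 * Real.exp 1 * D n := by
  have he := Real.exp_one_gt_d9
  exact (h.weight_le n).trans (mul_le_mul_of_nonneg_right (by linarith) (h.nonneg_D n))

/-- The excess of the ratio P/D over 2 halves at each step of a window of short steps. It starts
from p = 0 when the estimate is exact, and from p = `exp (t * Δ)` when nothing is known. -/
theorem DescentBounds.weight_le_of_window (h : DescentBounds D P α t B μ Δ)
    (hs : 5 ≤ Real.exp (t * Δ)) {n₀ : ℕ} {p δ : ℝ} (hp0 : 0 ≤ p) (hp : p ≤ Real.exp (t * Δ))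
    (hstart : P n₀ ≤ (2 + p) * D n₀) (hδ : t * B * δ ≤ 1 / 4) (i : ℕ)
    (hα : ∀ j < i, α (n₀ + j) * B * Real.exp (t * Δ) ≤ δ) :
    P (n₀ + i) ≤ (2 + p / 2 ^ i) * D (n₀ + i) + 6 * Real.exp (t * Δ) * δ ^ 2 := by
  induction i with
  | zero =>
    have : 0 ≤ 6 * Real.exp (t * Δ) * δ ^ 2 := by positivity
    simpa using by linarith
  | succ i ih =>
    have ih := ih fun j hj => hα j (by omega)
    have h1 := h.weight_succ (n₀ + i) δ (hα i (by omega)) hδ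
    have h2 := h.le_succ (n₀ + i) δ (hα i (by omega))
    have hP := h.nonneg_P (n₀ + i)
    have hD := h.nonneg_D (n₀ + i + 1)
    rw [← add_assoc]
    set s := Real.exp (t * Δ)
    set q := p / 2 ^ i with hq
    have hq0 : 0 ≤ q := by positivity
    have hqs : q ≤ s := (div_le_self hp0 (one_le_pow₀ (by norm_num))).trans hp
    have hq' : p / 2 ^ (i + 1) = q / 2 := by rw [hq, pow_succ]; field_simp
    rw [hq']
    have hk := one_div_two_exp_one_le
    -- Since 0.19 · (4/3) · (5/4)² < 0.4, a ratio 2 + q becomes at most 1 + 0.4(2 + q) ≤ 2 + q/2.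
    -- The bound 2 + q ≤ 1.4 s, which needs s ≥ 5, keeps the total noise coefficient below 6.
    have h3 : P (n₀ + i + 1) ≤ 0.19 * (4 / 3 * (5 / 4 * P (n₀ + i) + 5 * s * δ ^ 2))
        + D (n₀ + i + 1) := h1.trans (by gcongr)
    have h4 : (2 + q) * D (n₀ + i) ≤ (2 + q) * (5 / 4 * D (n₀ + i + 1) + 5 * δ ^ 2) := by gcongr
    have h5 : q * D (n₀ + i + 1) ≥ 0 := by positivity
    have h6 : (2 + q) * δ ^ 2 ≤ 1.4 * s * δ ^ 2 := by gcongr; linarith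
    have h7 : 0 ≤ s * δ ^ 2 := by positivity
    nlinarith

/-- The second term of the maximum is the fixed point V of the contraction D ↦ (1 - aμ/e) D +
(aBs)². -/
theorem DescentBounds.le_max_of_const_step (h : DescentBounds D P α t B μ Δ) {a : ℝ} (ha : 0 < a)
    {K : ℕ} (hα : ∀ n < K, α n = a) :
    ∀ n ≤ K, D n ≤ max (D 0) (Real.exp 1 * B ^ 2 * Real.exp (t * Δ) ^ 2 * a / μ) := by
  have he := Real.exp_one_gt_d9
  have ht := h.pos_t
  have hμ := h.pos_mu
  have hB := h.nonneg_B
  intro n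
  induction n with
  | zero => intro _; exact le_max_left _ _
  | succ n ih =>
    intro hn
    have ih := ih (by omega)
    have hαn := hα n (by omega)
    have hg := h.growth n
    have hc := h.contract n
    have hD := h.nonneg_D n
    rw [hαn] at hg hc
    -- Either a priori bound may already be below V. If not, c1 forces e s² aμ < 1 and c2 forces tBδ
    -- ≤ 1/4 for the step bound δ = aBs, at least when s > 5.
    by_cases c1 : B ^ 2 / μ ^ 2 ≤ Real.exp 1 * B ^ 2 * Real.exp (t * Δ) ^ 2 * a / μ
    · exact (h.le_sq_div _).trans (c1.trans (le_max_right _ _))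
    by_cases c2 : 2 * Δ / μ ≤ Real.exp 1 * B ^ 2 * Real.exp (t * Δ) ^ 2 * a / μ
    · exact (h.le_range_div _).trans (c2.trans (le_max_right _ _))
    push Not at c1 c2
    -- The window starts at time 0 with no excess, because the initial normalizer is exact.
    have hwin := fun hs => h.weight_le_of_window hs (n₀ := 0) (p := 0) (δ := a * B * Real.exp (t * Δ))
      le_rfl (Real.exp_pos _).le (by have := h.weight_zero; have := h.nonneg_D 0; linarith)
    have hlog := @two_mul_div_exp_one_le (t * Δ)
    set e := Real.exp 1
    set s := Real.exp (t * Δ)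
    set V := e * B ^ 2 * s ^ 2 * a / μ with hV
    have hs0 : 0 < s := Real.exp_pos _
    have hV0 : 0 ≤ V := by positivity
    have hB2 : 0 < B ^ 2 := by
      by_contra hb
      have : B ^ 2 = 0 := le_antisymm (not_lt.1 hb) (sq_nonneg B)
      simp [hV, this] at c1
    have hnoise : (a * B * s) ^ 2 = a * μ / e * V := by rw [hV]; field_simp
    have hsmall : e * s ^ 2 * (a * μ) < 1 := by
      rw [hV, div_lt_div_iff₀ hμ (by positivity)] at c1
      have : B ^ 2 * μ * (e * s ^ 2 * (a * μ)) < B ^ 2 * μ * 1 := by nlinarith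
      exact lt_of_mul_lt_mul_left this (by positivity)
    have haμ : 0 < a * μ := by positivity
    have hs1 : 1 ≤ s := h.one_le_exp
    have hrate : a * μ / e ≤ 1 / 2 := by
      rw [div_le_iff₀ (by linarith)]
      nlinarith [one_le_pow₀ hs1 (n := 2), mul_pos haμ (by linarith : 0 < e)]
    rw [hnoise] at hg hc
    -- Here the noise is at most V/2, so growth alone keeps D below V. In the other case V < 2 D n
    -- absorbs the noise term in the bound for P.
    by_cases c3 : D n ≤ V / 2
    · refine le_trans ?_ (le_max_right _ _)
      nlinarith
    push Not at c3
    have hcon : P n ≤ 2 * e * D n := by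
      rcases le_or_gt s 5 with h5 | h5
      · exact h.weight_le_of_exp_le h5 n
      · have hl := hlog h5.le
        have hδ : t * B * (a * B * s) ≤ 1 / 4 := by
          rw [hV, div_lt_div_iff_of_pos_right hμ] at c2
          have h1 : e * s * (t * B * (a * B * s)) < e * s * (1 / 4) := by
            have : t * (e * B ^ 2 * s ^ 2 * a) < t * (2 * Δ) := by gcongr
            nlinarith [mul_pos (by linarith : 0 < e) hs0]
          exact (lt_of_mul_lt_mul_left h1 (by positivity)).le
        have := hwin h5.le hδ n (fun j hj => by rw [zero_add, hα j (by omega)])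
        rw [zero_add, hnoise] at this
        have h6 : s * (a * μ / e) ≤ 0.05 := by
          rw [mul_div_assoc', div_le_iff₀ (by linarith)]
          nlinarith [mul_pos haμ hs0, mul_pos (mul_pos haμ hs0) (by linarith : 0 < e)]
        have h7 : s * (a * μ / e) * V ≤ 0.05 * V := by gcongr
        have h8 : P n ≤ 2 * D n + 6 * (s * (a * μ / e) * V) := by
          simp only [zero_div, add_zero] at this; linarith
        nlinarith
    have hfin := hc hcon
    have hVm := le_max_right (D 0) V
    have hr0 : 0 ≤ a * μ / e := by positivity
    nlinarith

-- With step 2e/(μk) the contraction factor is 1 - 2/k, and (1 - 2/k) V/k + V/k² ≤ V/(k+1). The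
-- bound on P is recovered by looking back over the second half of the history, which is long enough
-- to forget any earlier error of the normalizer.
set_option maxHeartbeats 1000000 in
theorem DescentBounds.le_div_of_harmonic_step (h : DescentBounds D P α t B μ Δ) {K : ℕ}
    (hα : ∀ n, K ≤ n → α n = 2 * Real.exp 1 / (μ * (n + 1)))
    (hα' : ∀ n < K, α n ≤ 2 * Real.exp 1 / (μ * (K + 1))) {V : ℝ} (hVK : (K + 1) * D K ≤ V)
    (hV₀ : 4 * B ^ 2 * Real.exp 1 ^ 2 * Real.exp (t * Δ) ^ 2 / μ ^ 2 ≤ V) :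
    ∀ n, K ≤ n → D n ≤ V / (n + 1) := by
  have he := Real.exp_one_gt_d9
  have ht := h.pos_t
  have hμ := h.pos_mu
  have hB := h.nonneg_B
  intro n hn
  induction n, hn using Nat.le_induction with
  | base => rw [le_div_iff₀ (by positivity)]; linarith
  | succ n hn ih =>
    have hαn := hα n hn
    have hg := h.growth n
    have hc := h.contract n
    have hD := h.nonneg_D n
    rw [hαn] at hg hc
    push_cast
    set V₀ := 4 * B ^ 2 * Real.exp 1 ^ 2 * Real.exp (t * Δ) ^ 2 / μ ^ 2 with hV₀d
    have hk0 : (0 : ℝ) < (n : ℝ) + 1 := by positivity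
    have hmono : V₀ / ((n : ℝ) + 1 + 1) ≤ V / ((n : ℝ) + 1 + 1) := by gcongr
    by_cases c1 : B ^ 2 / μ ^ 2 ≤ V₀ / ((n : ℝ) + 1 + 1)
    · exact (h.le_sq_div _).trans (c1.trans hmono)
    by_cases c2 : 2 * Δ / μ ≤ V₀ / ((n : ℝ) + 1 + 1)
    · exact (h.le_range_div _).trans (c2.trans hmono)
    push Not at c1 c2
    have hlog := @two_mul_div_exp_one_le (t * Δ)
    -- On the second half of the history the steps are at most twice the current one. The window may
    -- reach into the constant-step phase, which is why those steps must not exceed the first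
    -- harmonic one.
    have hstep : ∀ j : ℕ, n / 2 ≤ j → j < n →
        α j ≤ 2 * (2 * Real.exp 1 / (μ * (n + 1))) := by
      intro j hj hjn
      have key : ∀ i : ℕ, n + 1 ≤ 2 * (i + 1) →
          2 * Real.exp 1 / (μ * (i + 1)) ≤ 2 * (2 * Real.exp 1 / (μ * (n + 1))) := by
        intro i hi
        have hi' : (n : ℝ) + 1 ≤ 2 * (i + 1) := by exact_mod_cast hi
        rw [mul_div_assoc', div_le_div_iff₀ (by positivity) (by positivity)]
        nlinarith [mul_le_mul_of_nonneg_left hi' (mul_pos (Real.exp_pos 1) hμ).le]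
      rcases le_or_gt K j with hKj | hKj
      · rw [hα j hKj]; exact key j (by omega)
      · exact (hα' j hKj).trans (key K (by omega))
    have hwin := fun hs => h.weight_le_of_window hs (n₀ := n / 2) (p := Real.exp (t * Δ))
      (δ := 2 * (2 * Real.exp 1 / (μ * (n + 1))) * B * Real.exp (t * Δ))
      (Real.exp_pos _).le le_rfl
      (by have := h.weight_le (n / 2); have := h.nonneg_D (n / 2); linarith)
    set e := Real.exp 1
    set s := Real.exp (t * Δ)
    set k := (n : ℝ) + 1 with hk
    have hs0 : 0 < s := Real.exp_pos _
    have hV₀0 : 0 ≤ V₀ := by positivity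
    have hV0 : 0 ≤ V := hV₀0.trans hV₀
    have hB2 : 0 < B ^ 2 := by
      by_contra hb
      have : B ^ 2 = 0 := le_antisymm (not_lt.1 hb) (sq_nonneg B)
      simp [hV₀d, this] at c1
    have hnoise : (2 * e / (μ * k) * B * s) ^ 2 = V₀ / k ^ 2 := by rw [hV₀d]; field_simp; ring
    have hlarge : 4 * e ^ 2 * s ^ 2 < k + 1 := by
      rw [hV₀d, div_div, div_lt_div_iff₀ (by positivity) (by positivity)] at c1
      have : B ^ 2 * μ ^ 2 * (4 * e ^ 2 * s ^ 2) < B ^ 2 * μ ^ 2 * (k + 1) := by nlinarith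
      exact lt_of_mul_lt_mul_left this (by positivity)
    have hs1 : 1 ≤ s := h.one_le_exp
    have he2 : 7.38 ≤ e ^ 2 := by nlinarith
    have hlarge' : 29 * s ^ 2 < k + 1 := by
      have := mul_le_mul_of_nonneg_right he2 (sq_nonneg s)
      linarith [sq_nonneg s]
    have hk28 : 28 < k := by linarith [one_le_pow₀ hs1 (n := 2)]
    rw [hnoise] at hg hc
    have hVn : V₀ / k ^ 2 ≤ V / k ^ 2 := by gcongr
    -- Growth alone suffices here, since V/(2k) + V/k² ≤ V/(k+1) for large k. Otherwise V/k < 2 D n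
    -- absorbs the noise.
    by_cases c3 : D n ≤ V / (2 * k)
    · refine hg.trans ((add_le_add c3 hVn).trans ?_)
      have : V / (2 * k) + V / k ^ 2 = V * ((k + 2) / (2 * k ^ 2)) := by field_simp
      rw [this, div_eq_mul_one_div V (k + 1)]
      refine mul_le_mul_of_nonneg_left ?_ hV0
      rw [div_le_div_iff₀ (by positivity) (by positivity)]
      nlinarith
    push Not at c3
    have hcon : P n ≤ 2 * e * D n := by
      rcases le_or_gt s 5 with h5 | h5
      · exact h.weight_le_of_exp_le h5 n
      · have hl := hlog h5.le
        have hs5 : 5 * s ≤ s ^ 2 := by nlinarith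
        have hk700 : 145 * s < k + 1 := by linarith
        have hδ : t * B * (2 * (2 * e / (μ * k)) * B * s) ≤ 1 / 4 := by
          have hx : t * B * (2 * (2 * e / (μ * k)) * B * s) = 4 * e * t * B ^ 2 * s / (μ * k) := by
            field_simp; ring
          rw [hx, div_le_iff₀ (by positivity)]
          rw [hV₀d, div_div, div_lt_div_iff₀ (by positivity) hμ] at c2
          have h1 : e * s * μ * (16 * e * t * B ^ 2 * s) < e * s * μ * (μ * k) := by
            have h2 : t * (4 * B ^ 2 * e ^ 2 * s ^ 2 * μ) < t * (2 * Δ * (μ ^ 2 * (k + 1))) := by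
              gcongr
            have h3 : 2 * (t * Δ) * (μ ^ 2 * (k + 1)) ≤ 0.245 * e * s * (μ ^ 2 * (k + 1)) := by
              gcongr
            have h4 : 0.245 * e * s * (μ ^ 2 * (k + 1)) ≤ 0.25 * e * s * (μ ^ 2 * k) := by
              have : 0.245 * (k + 1) ≤ 0.25 * k := by linarith
              have := mul_le_mul_of_nonneg_left this (by positivity : 0 ≤ e * s * μ ^ 2)
              linarith
            linarith
          have := lt_of_mul_lt_mul_left h1 (by positivity)
          linarith
        have hP := hwin h5.le hδ (n - n / 2) (fun j hj => by
          have := hstep (n / 2 + j) (by omega) (by omega)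
          gcongr)
        rw [show n / 2 + (n - n / 2) = n by omega] at hP
        -- The window length m is at least n/2, hence at least s, and 2^m > m.
        have hpow : s / 2 ^ (n - n / 2) ≤ 1 := by
          rw [div_le_one (by positivity)]
          have h1 : ((n - n / 2 : ℕ) : ℝ) < 2 ^ (n - n / 2) := by
            exact_mod_cast Nat.lt_two_pow_self (n := n - n / 2)
          have h2 : (n : ℝ) ≤ 2 * ((n - n / 2 : ℕ) : ℝ) := by exact_mod_cast (by omega)
          linarith
        have hsq : (2 * (2 * e / (μ * k)) * B * s) ^ 2 = 4 * (V₀ / k ^ 2) := by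
          rw [← hnoise]; ring
        rw [hsq] at hP
        have h8 : 6 * s * (4 * (V₀ / k ^ 2)) ≤ 2 * (V / (2 * k)) := by
          have h9 : V₀ / k ^ 2 ≤ V / k ^ 2 := hVn
          have h10 : 24 * s ≤ k := by linarith
          have h11 : 2 * (V / (2 * k)) = k * (V / k ^ 2) := by field_simp
          have h12 : 0 ≤ V / k ^ 2 := by positivity
          have h14 := mul_le_mul_of_nonneg_right h10 h12
          have h15 := mul_le_mul_of_nonneg_left h9 (by positivity : 0 ≤ 24 * s)
          rw [h11]
          linarith
        have h13 : s / 2 ^ (n - n / 2) * D n ≤ 1 * D n := by gcongr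
        have h14 : 5 * D n ≤ 2 * e * D n := by gcongr; linarith
        linarith
    have hfin := hc hcon
    have hr : 2 * e / (μ * k) * μ / e = 2 / k := by field_simp
    rw [hr] at hfin
    have hr1 : 0 ≤ 1 - 2 / k := by
      rw [sub_nonneg, div_le_one hk0]; linarith
    refine hfin.trans ((add_le_add (mul_le_mul_of_nonneg_left ih hr1) hVn).trans ?_)
    have : (1 - 2 / k) * (V / k) + V / k ^ 2 = V * ((k - 1) / k ^ 2) := by field_simp; ring
    rw [this, div_eq_mul_one_div V (k + 1)]
    refine mul_le_mul_of_nonneg_left ?_ hV0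
    rw [div_le_div_iff₀ (by positivity) (by positivity)]
    nlinarith

end Recursion

/-! ### First-order consequences of strong convexity. -/

open Filter Topology in
theorem strongConvexOn_add_le_inner_gradient {E : Type*} [NormedAddCommGroup E]
    [InnerProductSpace ℝ E] [CompleteSpace E] {s : Set E} {μ : ℝ} {R : E → ℝ}
    (hR : StrongConvexOn s μ R) {x y g : E} (hx : x ∈ s) (hy : y ∈ s) (hg : HasGradientAt R g x) :
    R x - R y + μ / 2 * ‖x - y‖ ^ 2 ≤ inner ℝ g (x - y) := by
  have hline : HasDerivAt (fun τ : ℝ => R (x + τ • (y - x))) (inner ℝ g (y - x)) 0 := by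
    have h1 : HasDerivAt (fun τ : ℝ => x + τ • (y - x)) (y - x) 0 := by
      simpa using ((hasDerivAt_id (0 : ℝ)).smul_const (y - x)).const_add x
    have h2 : HasFDerivAt R (InnerProductSpace.toDual ℝ E g) (x + (0 : ℝ) • (y - x)) := by
      simpa using hg.hasFDerivAt
    have h3 := h2.comp_hasDerivAt (0 : ℝ) h1
    rw [InnerProductSpace.toDual_apply_apply] at h3
    exact h3
  have hlim := (hline.tendsto_slope_zero_right)
  have hlim' : Tendsto (fun τ : ℝ => R y - R x - (1 - τ) * (μ / 2 * ‖x - y‖ ^ 2)) (𝓝[>] 0)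
      (𝓝 (R y - R x - (1 - 0) * (μ / 2 * ‖x - y‖ ^ 2))) := by
    refine Tendsto.mono_left (Continuous.tendsto ?_ 0) nhdsWithin_le_nhds
    fun_prop
  -- The chord inequality with weight τ at y, divided by τ, bounds the difference quotient; then τ →
  -- 0+.
  have hle := le_of_tendsto_of_tendsto hlim hlim' (by
    have hev : ∀ᶠ τ : ℝ in 𝓝[>] 0, τ ∈ Set.Ioo (0 : ℝ) 1 := Ioo_mem_nhdsGT one_pos
    filter_upwards [hev] with τ hτ
    have := hR.2 hx hy (sub_nonneg.2 hτ.2.le) hτ.1.le (by ring)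
    have hpt : (1 - τ) • x + τ • y = x + τ • (y - x) := by module
    rw [hpt] at this
    simp only [zero_add, zero_smul, add_zero, smul_eq_mul] at this ⊢
    rw [inv_mul_le_iff₀ hτ.1]
    linarith)
  have : inner ℝ g (x - y) = - inner ℝ g (y - x) := by rw [← inner_neg_right, neg_sub]
  linarith

open Filter Topology in
theorem strongConvexOn_sq_dist_le_of_isMinOn {E : Type*} [NormedAddCommGroup E]
    [NormedSpace ℝ E] {s : Set E} {μ : ℝ} {R : E → ℝ}
    (hR : StrongConvexOn s μ R) {x y : E} (hx : x ∈ s) (hy : y ∈ s) (hmin : IsMinOn R s y) :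
    μ / 2 * ‖x - y‖ ^ 2 ≤ R x - R y := by
  have hlim : Tendsto (fun τ : ℝ => (1 - τ) * (μ / 2 * ‖x - y‖ ^ 2)) (𝓝[>] 0)
      (𝓝 ((1 - 0) * (μ / 2 * ‖x - y‖ ^ 2))) := by
    refine Tendsto.mono_left (Continuous.tendsto ?_ 0) nhdsWithin_le_nhds
    fun_prop
  have hle := le_of_tendsto hlim (b := R x - R y) (by
    have hev : ∀ᶠ τ : ℝ in 𝓝[>] 0, τ ∈ Set.Ioo (0 : ℝ) 1 := Ioo_mem_nhdsGT one_pos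
    filter_upwards [hev] with τ hτ
    have h1 := hR.2 hx hy hτ.1.le (sub_nonneg.2 hτ.2.le) (by ring)
    have h2 := hmin (hR.1 hx hy hτ.1.le (sub_nonneg.2 hτ.2.le) (by ring))
    simp only [smul_eq_mul, Set.mem_ofPred_eq] at h1 h2
    have h3 : τ * ((1 - τ) * (μ / 2 * ‖x - y‖ ^ 2)) ≤ τ * (R x - R y) := by linarith
    exact le_of_mul_le_mul_left h3 hτ.1)
  linarith

/-! ### Exponential weights of the tilted loss. -/

variable {d N : ℕ}

/-- The average of the weights `c i θ` over `i ∈ [N]`. -/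
noncomputable def meanWeight (c : Fin N → EuclideanSpace ℝ (Fin d) → ℝ)
    (θ : EuclideanSpace ℝ (Fin d)) : ℝ :=
  (∑ i, c i θ) / N

/-- What the analysis of the solver uses about the exponential weights `c i` and the unnormalized
gradients `w i` on the domain `Θ`, with `θs` the minimizer. -/
structure WeightBounds (Θ : Set (EuclideanSpace ℝ (Fin d))) (θs : EuclideanSpace ℝ (Fin d))
    (c : Fin N → EuclideanSpace ℝ (Fin d) → ℝ)
    (w : Fin N → EuclideanSpace ℝ (Fin d) → EuclideanSpace ℝ (Fin d)) (m t B μ Δ : ℝ) : Prop where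
  pos_m : 0 < m
  pos_t : 0 < t
  pos_mu : 0 < μ
  nonneg_B : 0 ≤ B
  nonneg_range : 0 ≤ Δ
  measurable_weight : ∀ i, Measurable (c i)
  measurable_grad : ∀ i, Measurable (w i)
  pos_weight : ∀ i θ, 0 < c i θ
  le_weight : ∀ i, ∀ θ ∈ Θ, m ≤ c i θ
  weight_le : ∀ i, ∀ θ ∈ Θ, c i θ ≤ Real.exp (t * Δ) * m
  norm_grad_le : ∀ i, ∀ θ ∈ Θ, ‖w i θ‖ ≤ B * meanWeight c θ
  le_inner : ∀ θ ∈ Θ, μ * meanWeight c θ * ‖θ - θs‖ ^ 2 ≤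
    (∑ i, inner ℝ (w i θ) (θ - θs)) / N
  meanWeight_le : ∀ θ ∈ Θ, ∀ θ' ∈ Θ,
    meanWeight c θ ≤ Real.exp (t * B * ‖θ - θ'‖) * meanWeight c θ'
  sq_dist_le_sq_div : ∀ θ ∈ Θ, ‖θ - θs‖ ^ 2 ≤ B ^ 2 / μ ^ 2
  sq_dist_le_range_div : ∀ θ ∈ Θ, ‖θ - θs‖ ^ 2 ≤ 2 * Δ / μ

section Tilted

variable {𝒳 : Type*} {f : 𝒳 → EuclideanSpace ℝ (Fin d) → ℝ} {x : Fin N → 𝒳} {t : ℝ}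

theorem exp_mul_tiltedLossOn (ht : 0 < t) {S : Finset (Fin N)} (hS : S.Nonempty)
    (θ : EuclideanSpace ℝ (Fin d)) :
    Real.exp (t * tiltedLossOn f x t S θ) = (∑ i ∈ S, Real.exp (t * f (x i) θ)) / S.card := by
  have hc : (0 : ℝ) < S.card := by exact_mod_cast hS.card_pos
  have hs : 0 < ∑ i ∈ S, Real.exp (t * f (x i) θ) :=
    Finset.sum_pos (fun i _ => Real.exp_pos _) hS
  rw [tiltedLossOn, ← mul_assoc, mul_one_div_cancel ht.ne', one_mul, Real.exp_log (by positivity)]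
  ring

/-- The weights `exp (t f(x_i; θ))`, made measurable by cutting off outside of `Θ`. -/
noncomputable def cutWeight (f : 𝒳 → EuclideanSpace ℝ (Fin d) → ℝ) (x : Fin N → 𝒳) (t : ℝ)
    (Θ : Set (EuclideanSpace ℝ (Fin d))) (i : Fin N) (θ : EuclideanSpace ℝ (Fin d)) : ℝ :=
  Real.exp (t * Θ.indicator (f (x i)) θ)

/-- The gradients `exp (t f(x_i; θ)) ∇f(x_i; θ)`, cut off outside of `Θ`. -/
noncomputable def cutGrad (f : 𝒳 → EuclideanSpace ℝ (Fin d) → ℝ) (x : Fin N → 𝒳) (t : ℝ)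
    (Θ : Set (EuclideanSpace ℝ (Fin d))) (i : Fin N) (θ : EuclideanSpace ℝ (Fin d)) :
    EuclideanSpace ℝ (Fin d) :=
  Θ.indicator (fun θ => Real.exp (t * f (x i) θ) • gradient (f (x i)) θ) θ

theorem measurable_indicator_of_continuousOn {α β : Type*} [TopologicalSpace α] [MeasurableSpace α]
    [BorelSpace α] [TopologicalSpace β] [MeasurableSpace β] [BorelSpace β] [Zero β]
    {s : Set α} {g : α → β} (hs : IsOpen s) (hg : ContinuousOn g s) :
    Measurable (s.indicator g) := by
  classical
  rw [← Set.piecewise_eq_indicator]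
  exact hg.measurable_piecewise continuousOn_const hs.measurableSet

theorem continuousOn_gradient {E : Type*} [NormedAddCommGroup E] [InnerProductSpace ℝ E]
    [CompleteSpace E] {s : Set E} {g : E → ℝ} (hs : IsOpen s) (hg : ContDiffOn ℝ 1 g s) :
    ContinuousOn (gradient g) s :=
  (InnerProductSpace.toDual ℝ E).symm.continuous.comp_continuousOn
    (hg.continuousOn_fderiv_of_isOpen hs le_rfl)

variable [NeZero N]

theorem exp_mul_tiltedLoss (ht : 0 < t) (θ : EuclideanSpace ℝ (Fin d)) :
    Real.exp (t * tiltedLoss f x t θ) = (∑ i, Real.exp (t * f (x i) θ)) / N := by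
  rw [tiltedLoss, exp_mul_tiltedLossOn ht Finset.univ_nonempty, Finset.card_univ, Fintype.card_fin]

theorem hasGradientAt_tiltedLoss (ht : 0 < t) {θ : EuclideanSpace ℝ (Fin d)}
    (hf : ∀ i, DifferentiableAt ℝ (f (x i)) θ) :
    HasGradientAt (tiltedLoss f x t) ((1 / (N : ℝ)) • ∑ i, tiltedStochGrad f x t i θ) θ := by
  have hN : (0 : ℝ) < N := by exact_mod_cast Nat.pos_of_ne_zero (NeZero.ne N)
  have hexp : ∀ i, HasFDerivAt (fun θ => Real.exp (t * f (x i) θ))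
      (Real.exp (t * f (x i) θ) • (t • InnerProductSpace.toDual ℝ _ (gradient (f (x i)) θ))) θ :=
    fun i => ((hf i).hasGradientAt.hasFDerivAt.const_mul t).exp
  have hsum := (HasFDerivAt.fun_sum fun i (_ : i ∈ Finset.univ) => hexp i).const_mul
    (1 / ((Finset.univ : Finset (Fin N)).card : ℝ))
  have hpos : 0 < ∑ i, Real.exp (t * f (x i) θ) :=
    Finset.sum_pos (fun i _ => Real.exp_pos _) Finset.univ_nonempty
  have hcard : ((Finset.univ : Finset (Fin N)).card : ℝ) = N := by simp
  have hlog := (hsum.log (by rw [hcard]; positivity)).const_mul (1 / t)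
  rw [hasGradientAt_iff_hasFDerivAt]
  refine hlog.congr_fderiv ?_
  ext v
  simp only [hcard, tiltedStochGrad, exp_mul_tiltedLoss ht]
  simp only [smul_apply, sum_apply, smul_eq_mul,
    InnerProductSpace.toDual_apply_apply, inner_smul_left, sum_inner, Finset.mul_sum, map_div₀,
    conj_trivial, map_one]
  refine Finset.sum_congr rfl fun i _ => ?_
  rw [← Finset.mul_sum]
  field_simp

/-- The mean weight is e^{tR̃}, so bounds on R̃ and its gradient become multiplicative bounds on the
weights. -/
theorem weightBounds_of_strongConvexOn {Θ : Set (EuclideanSpace ℝ (Fin d))} (hΘ : IsOpen Θ)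
    (ht : 0 < t) (hf : ∀ i, ContDiffOn ℝ 1 (f (x i)) Θ)
    {Fmin Fmax : ℝ} (hF : ∀ i, ∀ θ ∈ Θ, f (x i) θ ∈ Set.Icc Fmin Fmax)
    {μ : ℝ} (hμ : 0 < μ) (hsc : StrongConvexOn Θ μ (tiltedLoss f x t))
    {θs : EuclideanSpace ℝ (Fin d)} (hs : θs ∈ Θ) (hmin : IsMinOn (tiltedLoss f x t) Θ θs)
    {B : ℝ} (hB : ∀ i, ∀ θ ∈ Θ, ‖tiltedStochGrad f x t i θ‖ ≤ B) :
    WeightBounds Θ θs (cutWeight f x t Θ) (cutGrad f x t Θ) (Real.exp (t * Fmin)) t B μ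
      (Fmax - Fmin) := by
  have hN : (0 : ℝ) < N := by exact_mod_cast Nat.pos_of_ne_zero (NeZero.ne N)
  have hB0 : 0 ≤ B := (norm_nonneg _).trans (hB 0 θs hs)
  have hcw : ∀ i, ∀ θ ∈ Θ, cutWeight f x t Θ i θ = Real.exp (t * f (x i) θ) := fun i θ hθ => by
    rw [cutWeight, Set.indicator_of_mem hθ]
  have hmean : ∀ θ ∈ Θ, meanWeight (cutWeight f x t Θ) θ = Real.exp (t * tiltedLoss f x t θ) :=
    fun θ hθ => by
      rw [meanWeight, exp_mul_tiltedLoss ht, Finset.sum_congr rfl fun i _ => hcw i θ hθ]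
  have hcg : ∀ i, ∀ θ ∈ Θ, cutGrad f x t Θ i θ =
      meanWeight (cutWeight f x t Θ) θ • tiltedStochGrad f x t i θ := fun i θ hθ => by
    rw [cutGrad, Set.indicator_of_mem hθ, tiltedStochGrad, hmean θ hθ, smul_smul,
      mul_div_cancel₀ _ (Real.exp_pos _).ne']
  have hgrad : ∀ θ ∈ Θ, HasGradientAt (tiltedLoss f x t)
      ((1 / (N : ℝ)) • ∑ i, tiltedStochGrad f x t i θ) θ := fun θ hθ =>
    hasGradientAt_tiltedLoss ht fun i =>
      ((hf i).differentiableOn one_ne_zero).differentiableAt (hΘ.mem_nhds hθ)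
  have hgrad_le : ∀ θ ∈ Θ, ‖(1 / (N : ℝ)) • ∑ i, tiltedStochGrad f x t i θ‖ ≤ B := by
    intro θ hθ
    rw [norm_smul, Real.norm_of_nonneg (by positivity), one_div_mul_eq_div, div_le_iff₀ hN]
    refine (norm_sum_le _ _).trans ((Finset.sum_le_sum fun i _ => hB i θ hθ).trans ?_)
    simp [mul_comm]
  -- The gradient inequality and quadratic growth at the minimizer each contribute μ/2.
  have hmono : ∀ θ ∈ Θ, μ * ‖θ - θs‖ ^ 2 ≤
      inner ℝ ((1 / (N : ℝ)) • ∑ i, tiltedStochGrad f x t i θ) (θ - θs) := by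
    intro θ hθ
    have h1 := strongConvexOn_add_le_inner_gradient hsc hθ hs (hgrad θ hθ)
    have h2 := strongConvexOn_sq_dist_le_of_isMinOn hsc hθ hs hmin
    linarith
  have hrange : ∀ θ ∈ Θ, tiltedLoss f x t θ ∈ Set.Icc Fmin Fmax := by
    intro θ hθ
    have h1 : Real.exp (t * Fmin) ≤ Real.exp (t * tiltedLoss f x t θ) := by
      rw [exp_mul_tiltedLoss ht, le_div_iff₀ hN]
      have := Finset.card_nsmul_le_sum Finset.univ (fun i => Real.exp (t * f (x i) θ))
        (Real.exp (t * Fmin)) fun i _ => by gcongr; exact (hF i θ hθ).1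
      simpa [mul_comm] using this
    have h2 : Real.exp (t * tiltedLoss f x t θ) ≤ Real.exp (t * Fmax) := by
      rw [exp_mul_tiltedLoss ht, div_le_iff₀ hN]
      have := Finset.sum_le_card_nsmul Finset.univ (fun i => Real.exp (t * f (x i) θ))
        (Real.exp (t * Fmax)) fun i _ => by gcongr; exact (hF i θ hθ).2
      simpa [mul_comm] using this
    exact ⟨le_of_mul_le_mul_left (Real.exp_le_exp.1 h1) ht,
      le_of_mul_le_mul_left (Real.exp_le_exp.1 h2) ht⟩
  refine ⟨Real.exp_pos _, ht, hμ, hB0, ?_, ?_, ?_, fun _ _ => Real.exp_pos _, ?_, ?_, ?_, ?_, ?_,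
    ?_, ?_⟩
  · linarith [(hF 0 θs hs).1, (hF 0 θs hs).2]
  · intro i
    exact ((measurable_indicator_of_continuousOn hΘ (hf i).continuousOn).const_mul t).exp
  · intro i
    exact measurable_indicator_of_continuousOn hΘ
      (((hf i).continuousOn.const_smul t).rexp.smul (continuousOn_gradient hΘ (hf i)))
  · intro i θ hθ
    rw [hcw i θ hθ]; gcongr; exact (hF i θ hθ).1
  · intro i θ hθ
    rw [hcw i θ hθ, ← Real.exp_add]
    gcongr
    nlinarith [(hF i θ hθ).2]
  · intro i θ hθ
    rw [hcg i θ hθ, norm_smul, hmean θ hθ, Real.norm_of_nonneg (Real.exp_pos _).le, mul_comm]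
    gcongr
    exact hB i θ hθ
  · intro θ hθ
    have h1 := mul_le_mul_of_nonneg_left (hmono θ hθ) (Real.exp_pos (t * tiltedLoss f x t θ)).le
    rw [← hmean θ hθ] at h1
    rw [inner_smul_left, sum_inner] at h1
    rw [Finset.sum_congr rfl fun i _ => by rw [hcg i θ hθ, inner_smul_left], ← Finset.mul_sum]
    simp only [conj_trivial] at h1 ⊢
    calc _ = _ := by ring
      _ ≤ _ := h1
      _ = _ := by ring
  -- The gradient of R̃ is an average of stochastic gradients, so R̃ is B-Lipschitz on the convex
  -- set Θ.
  · intro θ hθ θ' hθ'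
    rw [hmean θ hθ, hmean θ' hθ', ← Real.exp_add]
    have h1 := hsc.1.norm_image_sub_le_of_norm_hasFDerivWithin_le (C := B)
      (fun θ hθ => (hgrad θ hθ).hasFDerivAt.hasFDerivWithinAt)
      (fun θ hθ => by rw [LinearIsometryEquiv.norm_map]; exact hgrad_le θ hθ) hθ' hθ
    have h2 := (le_abs_self _).trans (Real.norm_eq_abs _ ▸ h1)
    gcongr
    nlinarith
  · intro θ hθ
    have h1 := (hmono θ hθ).trans (real_inner_le_norm _ _)
    have h2 := h1.trans (mul_le_mul_of_nonneg_right (hgrad_le θ hθ) (norm_nonneg _))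
    rw [← div_pow]
    gcongr
    rw [le_div_iff₀ hμ]
    rcases (norm_nonneg (θ - θs)).eq_or_lt with h0 | h0
    · rw [← h0]; simpa using hB0
    · nlinarith
  · intro θ hθ
    have h2 := strongConvexOn_sq_dist_le_of_isMinOn hsc hθ hs hmin
    rw [le_div_iff₀ hμ]
    linarith [(hrange θ hθ).2, (hrange θs hs).1]

end Tilted

/-! ### Independence of the past from a fresh uniform sample. -/

section Independence

variable {Ω : Type*} [MeasurableSpace Ω] {P : Measure Ω}

/-- The joint law factors as a triple product, which is then reassociated. -/
theorem indepFun_prodMk_of_indepFun [IsProbabilityMeasure P] {α β γ : Type*} [MeasurableSpace α] [MeasurableSpace β]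
    [MeasurableSpace γ] {X : Ω → α} {Y : Ω → β} {Z : Ω → γ} (hX : Measurable X) (hY : Measurable Y)
    (hZ : Measurable Z) (hXYZ : IndepFun X (fun ω => (Y ω, Z ω)) P) (hYZ : IndepFun Y Z P) :
    IndepFun (fun ω => (X ω, Y ω)) Z P := by
  have hXY : IndepFun X Y P := hXYZ.comp measurable_id measurable_fst
  have h1 := (indepFun_iff_map_prod_eq_prod_map_map hX.aemeasurable
    (hY.prodMk hZ).aemeasurable).1 hXYZ
  have h2 := (indepFun_iff_map_prod_eq_prod_map_map hY.aemeasurable hZ.aemeasurable).1 hYZ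
  have h3 := (indepFun_iff_map_prod_eq_prod_map_map hX.aemeasurable hY.aemeasurable).1 hXY
  have := Measure.isProbabilityMeasure_map (μ := P) hX.aemeasurable
  have := Measure.isProbabilityMeasure_map (μ := P) hY.aemeasurable
  have := Measure.isProbabilityMeasure_map (μ := P) hZ.aemeasurable
  rw [indepFun_iff_map_prod_eq_prod_map_map (hX.prodMk hY).aemeasurable hZ.aemeasurable, h3]
  rw [h2, ← Measure.prodAssoc_prod] at h1
  have h4 := congrArg (Measure.map MeasurableEquiv.prodAssoc.symm) h1
  rw [MeasurableEquiv.map_symm_map, Measure.map_map (MeasurableEquiv.measurable _)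
    (hX.prodMk (hY.prodMk hZ))] at h4
  exact h4

theorem indepFun_of_eq_of_forall_mem [IsProbabilityMeasure P] {ι α β γ : Type*}
    [MeasurableSpace α] [MeasurableSpace β] [MeasurableSpace γ] [Nonempty β] {X : Ω → α} {Z : ι → Ω → β} (hX : Measurable X)
    (hZ : ∀ j, Measurable (Z j)) (hind : iIndepFun Z P)
    (hind' : IndepFun X (fun ω j => Z j ω) P) {S : Finset ι} {j₀ : ι} (hj₀ : j₀ ∉ S)
    {G : α × (ι → β) → γ} (hG : Measurable G)
    (hdep : ∀ a z z', (∀ j ∈ S, z j = z' j) → G (a, z) = G (a, z')) :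
    IndepFun (fun ω => G (X ω, fun j => Z j ω)) (Z j₀) P := by
  classical
  let b₀ : β := Classical.arbitrary β
  have hYZ : IndepFun (fun ω (j : S) => Z j ω) (Z j₀) P :=
    (hind.indepFun_finset S {j₀} (by simpa using hj₀) hZ).comp measurable_id
      (measurable_pi_apply (⟨j₀, by simp⟩ : ({j₀} : Finset ι)))
  have hXYZ : IndepFun X (fun ω => ((fun j : S => Z j ω), Z j₀ ω)) P :=
    hind'.comp measurable_id (ψ := fun z : ι → β => ((fun j : S => z j), z j₀)) (by fun_prop)
  have hXY := indepFun_prodMk_of_indepFun hX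
    (measurable_pi_lambda (fun ω (j : S) => Z j ω) fun j => hZ j) (hZ j₀) hXYZ hYZ
  -- Coordinates outside S are filled with an arbitrary value, which G cannot see by `hdep`.
  let ext : (S → β) → ι → β := fun b j => if h : j ∈ S then b ⟨j, h⟩ else b₀
  have hext : Measurable ext := measurable_pi_lambda _ fun j => by
    by_cases h : j ∈ S
    · simpa only [ext, h, dif_pos] using measurable_pi_apply (⟨j, h⟩ : S)
    · simp only [ext, h, dif_neg, not_false_eq_true, measurable_const]
  have := hXY.comp (φ := fun p : α × (S → β) => G (p.1, ext p.2)) (ψ := id)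
    (hG.comp (measurable_fst.prodMk (hext.comp measurable_snd))) measurable_id
  refine Eq.mp (congrArg (fun g => IndepFun g (Z j₀) P) (funext fun ω => ?_)) this
  symm
  exact hdep _ _ _ fun j hj => by simp [ext, hj]

variable [NeZero N]

/-- Splitting along the value of ζ turns the integrand into finitely many products of independent
factors. This replaces conditioning on the past. -/
theorem integral_comp_uniform {α : Type*} [MeasurableSpace α] {S : Ω → α} (hS : Measurable S)
    {ζ : Ω → Fin N} (hζ : Measurable ζ)
    (hu : P.map ζ = (PMF.uniformOfFintype (Fin N)).toMeasure) (hind : IndepFun S ζ P)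
    {G : Fin N → α → ℝ} (hG : ∀ i, Measurable (G i))
    (hint : ∀ i, Integrable (fun ω => G i (S ω)) P) :
    Integrable (fun ω => G (ζ ω) (S ω)) P ∧
      ∫ ω, G (ζ ω) (S ω) ∂P = ∫ ω, (∑ i, G i (S ω)) / N ∂P := by
  have hsum : (fun ω => G (ζ ω) (S ω)) =
      fun ω => ∑ i, G i (S ω) * ({i} : Set (Fin N)).indicator 1 (ζ ω) := by
    funext ω
    rw [Finset.sum_eq_single (ζ ω)]
    · simp
    · intro i _ hi
      simp [Set.indicator, hi.symm]
    · simp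
  have hmeas : ∀ i : Fin N, Measurable (({i} : Set (Fin N)).indicator (1 : Fin N → ℝ)) :=
    fun i => measurable_one.indicator (measurableSet_singleton i)
  have hi : ∀ i, Integrable
      (fun ω => G i (S ω) * ({i} : Set (Fin N)).indicator (1 : Fin N → ℝ) (ζ ω)) P := fun i => by
    refine (hint i).mul_bdd (c := 1) ((hmeas i).comp hζ).aestronglyMeasurable
      (Filter.Eventually.of_forall fun ω => ?_)
    by_cases h : ζ ω = i <;> simp [Set.indicator, h]
  have hmass : ∀ i : Fin N,
      ∫ ω, ({i} : Set (Fin N)).indicator (1 : Fin N → ℝ) (ζ ω) ∂P = (N : ℝ)⁻¹ := fun i => by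
    rw [← integral_map hζ.aemeasurable (hmeas i).aestronglyMeasurable, hu,
      integral_indicator_one (measurableSet_singleton i), Measure.real,
      PMF.toMeasure_apply_singleton _ _ (measurableSet_singleton i)]
    simp
  rw [hsum]
  refine ⟨integrable_finsetSum _ fun i _ => hi i, ?_⟩
  rw [integral_finsetSum _ fun i _ => hi i, integral_div, integral_finsetSum _ fun i _ => hint i,
    Finset.sum_div]
  refine Finset.sum_congr rfl fun i _ => ?_
  rw [hind.integral_fun_comp_mul_comp hS.aemeasurable hζ.aemeasurable
    (hG i).aestronglyMeasurable (hmeas i).aestronglyMeasurable, hmass, div_eq_mul_inv]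

end Independence

/-! ### The stochastic process and its moment bounds. -/

variable {Ω : Type*} [MeasurableSpace Ω]

/-- A run of the solver in the domain `Θ`, for the parameters `y n` and the exponentiated
normalizer estimates `u n`, with averaging parameter `1 - 1/(2e)`. -/
structure SolverProcess [NeZero N] (P : Measure Ω) (Θ : Set (EuclideanSpace ℝ (Fin d)))
    (c : Fin N → EuclideanSpace ℝ (Fin d) → ℝ)
    (w : Fin N → EuclideanSpace ℝ (Fin d) → EuclideanSpace ℝ (Fin d)) (α : ℕ → ℝ)
    (y : ℕ → Ω → EuclideanSpace ℝ (Fin d)) (u : ℕ → Ω → ℝ) (ζ ξ : ℕ → Ω → Fin N) : Prop where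
  nonneg_step : ∀ n, 0 ≤ α n
  measurable_param : ∀ n, Measurable (y n)
  measurable_normalizer : ∀ n, Measurable (u n)
  measurable_gradSample : ∀ n, Measurable (ζ n)
  measurable_normSample : ∀ n, Measurable (ξ n)
  gradSample_uniform : ∀ n, P.map (ζ n) = (PMF.uniformOfFintype (Fin N)).toMeasure
  normSample_uniform : ∀ n, P.map (ξ n) = (PMF.uniformOfFintype (Fin N)).toMeasure
  indep_gradSample : ∀ n, IndepFun (fun ω => (y n ω, u (n + 1) ω)) (ζ n) P
  indep_normSample : ∀ n, IndepFun (fun ω => (y n ω, u n ω)) (ξ n) P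
  normalizer_zero : ∀ ω, u 0 ω = meanWeight c (y 0 ω)
  normalizer_succ : ∀ n ω, u (n + 1) ω =
    1 / (2 * Real.exp 1) * u n ω + (1 - 1 / (2 * Real.exp 1)) * c (ξ n ω) (y n ω)
  param_succ : ∀ n ω, y (n + 1) ω = y n ω - (α n / u (n + 1) ω) • w (ζ n ω) (y n ω)
  mem : ∀ n, ∀ᵐ ω ∂P, y n ω ∈ Θ

namespace WeightBounds

variable {Θ : Set (EuclideanSpace ℝ (Fin d))} {θs : EuclideanSpace ℝ (Fin d)}
  {c : Fin N → EuclideanSpace ℝ (Fin d) → ℝ}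
  {w : Fin N → EuclideanSpace ℝ (Fin d) → EuclideanSpace ℝ (Fin d)} {m t B μ Δ : ℝ}

theorem measurable_meanWeight (W : WeightBounds Θ θs c w m t B μ Δ) :
    Measurable (meanWeight c) :=
  (Finset.measurable_fun_sum _ fun i _ => W.measurable_weight i).div_const _

variable [NeZero N]

theorem le_meanWeight (W : WeightBounds Θ θs c w m t B μ Δ) {θ : EuclideanSpace ℝ (Fin d)}
    (hθ : θ ∈ Θ) : m ≤ meanWeight c θ := by
  have hN : (0 : ℝ) < N := by exact_mod_cast Nat.pos_of_ne_zero (NeZero.ne N)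
  rw [meanWeight, le_div_iff₀ hN]
  have := Finset.card_nsmul_le_sum Finset.univ (fun i => c i θ) m fun i _ => W.le_weight i θ hθ
  simpa [mul_comm] using this

theorem meanWeight_le_mul (W : WeightBounds Θ θs c w m t B μ Δ) {θ : EuclideanSpace ℝ (Fin d)}
    (hθ : θ ∈ Θ) : meanWeight c θ ≤ Real.exp (t * Δ) * m := by
  have hN : (0 : ℝ) < N := by exact_mod_cast Nat.pos_of_ne_zero (NeZero.ne N)
  rw [meanWeight, div_le_iff₀ hN]
  have := Finset.sum_le_card_nsmul Finset.univ (fun i => c i θ) _ fun i _ => W.weight_le i θ hθ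
  simpa [mul_comm] using this

end WeightBounds

theorem one_div_two_exp_one_mem : 1 / (2 * Real.exp 1) ∈ Set.Ioo (0 : ℝ) 1 :=
  ⟨by positivity, one_div_two_exp_one_le.trans_lt (by norm_num)⟩

/-- The mean of the squared distance weighted by the relative normalizer. -/
noncomputable def relWeight (P : Measure Ω) (θs : EuclideanSpace ℝ (Fin d))
    (c : Fin N → EuclideanSpace ℝ (Fin d) → ℝ) (y : Ω → EuclideanSpace ℝ (Fin d)) (v : Ω → ℝ) : ℝ :=
  ∫ ω, ‖y ω - θs‖ ^ 2 * (v ω / meanWeight c (y ω)) ∂P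

namespace SolverProcess

variable [NeZero N] {P : Measure Ω}
  {Θ : Set (EuclideanSpace ℝ (Fin d))} {θs : EuclideanSpace ℝ (Fin d)}
  {c : Fin N → EuclideanSpace ℝ (Fin d) → ℝ}
  {w : Fin N → EuclideanSpace ℝ (Fin d) → EuclideanSpace ℝ (Fin d)} {m t B μ Δ : ℝ}
  {α : ℕ → ℝ} {y : ℕ → Ω → EuclideanSpace ℝ (Fin d)} {u : ℕ → Ω → ℝ} {ζ ξ : ℕ → Ω → Fin N}

theorem normalizer_mem (S : SolverProcess P Θ c w α y u ζ ξ)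
    (W : WeightBounds Θ θs c w m t B μ Δ) (n : ℕ) :
    ∀ᵐ ω ∂P, m ≤ u n ω ∧ u n ω ≤ Real.exp (t * Δ) * m := by
  induction n with
  | zero =>
    filter_upwards [S.mem 0] with ω hω
    rw [S.normalizer_zero]
    exact ⟨W.le_meanWeight hω, W.meanWeight_le_mul hω⟩
  | succ n ih =>
    filter_upwards [S.mem n, ih] with ω hω hu
    have h1 := W.le_weight (ξ n ω) _ hω
    have h2 := W.weight_le (ξ n ω) _ hω
    obtain ⟨hκ0, hκ1⟩ := one_div_two_exp_one_mem
    rw [S.normalizer_succ]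
    constructor <;> nlinarith

theorem div_meanWeight_mem (S : SolverProcess P Θ c w α y u ζ ξ)
    (W : WeightBounds Θ θs c w m t B μ Δ) (n k : ℕ) :
    ∀ᵐ ω ∂P, 0 ≤ u k ω / meanWeight c (y n ω) ∧
      u k ω / meanWeight c (y n ω) ≤ Real.exp (t * Δ) := by
  filter_upwards [S.mem n, S.normalizer_mem W k] with ω hω hu
  have hm := W.pos_m
  have h1 := W.le_meanWeight hω
  refine ⟨div_nonneg (by linarith) (by linarith), ?_⟩
  rw [div_le_iff₀ (by linarith)]
  exact hu.2.trans (by gcongr)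

theorem meanWeight_div_mem (S : SolverProcess P Θ c w α y u ζ ξ)
    (W : WeightBounds Θ θs c w m t B μ Δ) (n k : ℕ) :
    ∀ᵐ ω ∂P, 0 ≤ meanWeight c (y n ω) / u k ω ∧
      meanWeight c (y n ω) / u k ω ≤ Real.exp (t * Δ) := by
  filter_upwards [S.mem n, S.normalizer_mem W k] with ω hω hu
  have hm := W.pos_m
  have h1 := W.le_meanWeight hω
  have h2 := W.meanWeight_le_mul hω
  refine ⟨div_nonneg (by linarith) (by linarith), ?_⟩
  rw [div_le_iff₀ (by linarith)]
  exact h2.trans (by gcongr; exact hu.1)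

theorem norm_step_le (S : SolverProcess P Θ c w α y u ζ ξ)
    (W : WeightBounds Θ θs c w m t B μ Δ) (n : ℕ) :
    ∀ᵐ ω ∂P, ‖(α n / u (n + 1) ω) • w (ζ n ω) (y n ω)‖ ≤ α n * B * Real.exp (t * Δ) := by
  filter_upwards [S.mem n, S.normalizer_mem W (n + 1), S.meanWeight_div_mem W n (n + 1)]
    with ω hω hu hr
  have hu0 : 0 < u (n + 1) ω := W.pos_m.trans_le hu.1
  have hα := S.nonneg_step n
  have hB := W.nonneg_B
  rw [norm_smul, Real.norm_of_nonneg (by positivity)]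
  calc α n / u (n + 1) ω * ‖w (ζ n ω) (y n ω)‖
      ≤ α n / u (n + 1) ω * (B * meanWeight c (y n ω)) := by
        gcongr; exact W.norm_grad_le _ _ hω
    _ = α n * B * (meanWeight c (y n ω) / u (n + 1) ω) := by ring
    _ ≤ _ := by gcongr; exact hr.2

variable [IsProbabilityMeasure P]

theorem integrable_sq_dist (S : SolverProcess P Θ c w α y u ζ ξ)
    (W : WeightBounds Θ θs c w m t B μ Δ) (n : ℕ) :
    Integrable (fun ω => ‖y n ω - θs‖ ^ 2) P := by
  refine Integrable.of_bound (C := B ^ 2 / μ ^ 2)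
    (((S.measurable_param n).sub_const _).norm.pow_const 2).aestronglyMeasurable ?_
  filter_upwards [S.mem n] with ω hω
  rw [Real.norm_of_nonneg (by positivity)]
  exact W.sq_dist_le_sq_div _ hω

theorem integrable_sq_dist_mul (S : SolverProcess P Θ c w α y u ζ ξ)
    (W : WeightBounds Θ θs c w m t B μ Δ) (n : ℕ) {h : Ω → ℝ} (hm : Measurable h) {C : ℝ}
    (hC : ∀ᵐ ω ∂P, |h ω| ≤ C) :
    Integrable (fun ω => ‖y n ω - θs‖ ^ 2 * h ω) P :=
  (S.integrable_sq_dist W n).mul_bdd (c := C) hm.aestronglyMeasurable hC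

theorem integrable_relWeight (S : SolverProcess P Θ c w α y u ζ ξ)
    (W : WeightBounds Θ θs c w m t B μ Δ) (n k : ℕ) :
    Integrable (fun ω => ‖y n ω - θs‖ ^ 2 * (u k ω / meanWeight c (y n ω))) P := by
  refine S.integrable_sq_dist_mul W n (C := Real.exp (t * Δ))
    ((S.measurable_normalizer k).div (W.measurable_meanWeight.comp (S.measurable_param n))) ?_
  filter_upwards [S.div_meanWeight_mem W n k] with ω h
  rw [abs_of_nonneg h.1]; exact h.2

theorem integrable_sq_dist_mul_div (S : SolverProcess P Θ c w α y u ζ ξ)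
    (W : WeightBounds Θ θs c w m t B μ Δ) (n : ℕ) :
    Integrable (fun ω => ‖y n ω - θs‖ ^ 2 * (meanWeight c (y n ω) / u (n + 1) ω)) P := by
  refine S.integrable_sq_dist_mul W n (C := Real.exp (t * Δ))
    ((W.measurable_meanWeight.comp (S.measurable_param n)).div (S.measurable_normalizer _)) ?_
  filter_upwards [S.meanWeight_div_mem W n (n + 1)] with ω h
  rw [abs_of_nonneg h.1]; exact h.2

/-- An equality because the relative weights c i / meanWeight average to 1 and the fresh sample is
independent of the current parameter and old normalizer. -/
theorem relWeight_succ_eq (S : SolverProcess P Θ c w α y u ζ ξ)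
    (W : WeightBounds Θ θs c w m t B μ Δ) (n : ℕ) :
    relWeight P θs c (y n) (u (n + 1)) = 1 / (2 * Real.exp 1) * relWeight P θs c (y n) (u n)
      + (1 - 1 / (2 * Real.exp 1)) * ∫ ω, ‖y n ω - θs‖ ^ 2 ∂P := by
  have hN : (0 : ℝ) < N := by exact_mod_cast Nat.pos_of_ne_zero (NeZero.ne N)
  set κ := 1 / (2 * Real.exp 1)
  have hmW := W.measurable_meanWeight
  have hmc := W.measurable_weight
  have hmy := S.measurable_param n
  have hI : ∀ i, Integrable
      (fun ω => ‖y n ω - θs‖ ^ 2 * (c i (y n ω) / meanWeight c (y n ω))) P := fun i => by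
    refine S.integrable_sq_dist_mul W n (C := Real.exp (t * Δ))
      (((hmc i).comp hmy).div (hmW.comp hmy)) ?_
    filter_upwards [S.mem n] with ω hω
    have hm := W.pos_m
    have h1 := W.le_meanWeight hω
    rw [abs_of_nonneg (div_nonneg (W.pos_weight i _).le (by linarith)), div_le_iff₀ (by linarith)]
    exact (W.weight_le i _ hω).trans (by gcongr)
  have hG := integral_comp_uniform (P := P) (S := fun ω => (y n ω, u n ω))
    (hmy.prodMk (S.measurable_normalizer n)) (S.measurable_normSample n)
    (S.normSample_uniform n) (S.indep_normSample n)
    (G := fun i p => ‖p.1 - θs‖ ^ 2 * (c i p.1 / meanWeight c p.1))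
    (fun i => by fun_prop) hI
  have hsum : ∫ ω, (∑ i, ‖y n ω - θs‖ ^ 2 * (c i (y n ω) / meanWeight c (y n ω))) / N ∂P =
      ∫ ω, ‖y n ω - θs‖ ^ 2 ∂P := by
    refine integral_congr_ae ?_
    filter_upwards [S.mem n] with ω hω
    have hp : 0 < meanWeight c (y n ω) := W.pos_m.trans_le (W.le_meanWeight hω)
    rw [← Finset.mul_sum, ← Finset.sum_div, mul_div_assoc, div_right_comm]
    change _ * (meanWeight c (y n ω) / meanWeight c (y n ω)) = _
    rw [div_self hp.ne', mul_one]
  rw [← hsum, ← hG.2, relWeight, relWeight, ← integral_const_mul, ← integral_const_mul,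
    ← integral_add ((S.integrable_relWeight W n n).const_mul _) (hG.1.const_mul _)]
  refine integral_congr_ae (Filter.Eventually.of_forall fun ω => ?_)
  simp only [S.normalizer_succ]
  ring

/-- Expand the square; the independent gradient sample averages the cross term, which strong
convexity bounds below. -/
theorem integral_sq_dist_succ_le (S : SolverProcess P Θ c w α y u ζ ξ)
    (W : WeightBounds Θ θs c w m t B μ Δ) (n : ℕ) :
    ∫ ω, ‖y (n + 1) ω - θs‖ ^ 2 ∂P ≤ ∫ ω, ‖y n ω - θs‖ ^ 2 ∂P
      - 2 * α n * μ * ∫ ω, ‖y n ω - θs‖ ^ 2 * (meanWeight c (y n ω) / u (n + 1) ω) ∂P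
      + (α n * B * Real.exp (t * Δ)) ^ 2 := by
  have hN : (0 : ℝ) < N := by exact_mod_cast Nat.pos_of_ne_zero (NeZero.ne N)
  have hmw := W.measurable_grad
  have hmW := W.measurable_meanWeight
  have hmy := S.measurable_param n
  have hmu := S.measurable_normalizer (n + 1)
  have hα := S.nonneg_step n
  have hJ := S.integrable_sq_dist_mul_div W n
  have hI : ∀ i, Integrable
      (fun ω => inner ℝ (w i (y n ω)) (y n ω - θs) / u (n + 1) ω) P := fun i => by
    refine Integrable.of_bound (C := B * Real.exp (t * Δ) * (B / μ)) ?_ ?_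
    · exact ((((hmw i).comp hmy).inner (hmy.sub_const θs)).div hmu).aestronglyMeasurable
    filter_upwards [S.mem n, S.normalizer_mem W (n + 1), S.meanWeight_div_mem W n (n + 1)]
      with ω hω hu hr
    have hu0 : 0 < u (n + 1) ω := W.pos_m.trans_le hu.1
    have hB := W.nonneg_B
    have hμ := W.pos_mu
    have hd : ‖y n ω - θs‖ ≤ B / μ := by
      have := W.sq_dist_le_sq_div _ hω
      rw [← div_pow] at this
      exact (sq_le_sq₀ (norm_nonneg _) (by positivity)).1 this
    rw [norm_div, Real.norm_of_nonneg hu0.le, div_le_iff₀ hu0]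
    refine (norm_inner_le_norm _ _).trans ?_
    have h1 := W.norm_grad_le i _ hω
    have h2 := (div_le_iff₀ hu0).1 hr.2
    calc ‖w i (y n ω)‖ * ‖y n ω - θs‖ ≤ (B * (Real.exp (t * Δ) * u (n + 1) ω)) * (B / μ) := by
          gcongr; exact h1.trans (by gcongr)
      _ = _ := by ring
  have hG := integral_comp_uniform (P := P) (S := fun ω => (y n ω, u (n + 1) ω))
    (hmy.prodMk hmu) (S.measurable_gradSample n)
    (S.gradSample_uniform n) (S.indep_gradSample n)
    (G := fun i p => inner ℝ (w i p.1) (p.1 - θs) / p.2)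
    (fun i => (((hmw i).comp measurable_fst).inner (measurable_fst.sub_const θs)).div
      measurable_snd) hI
  have hsum : μ * ∫ ω, ‖y n ω - θs‖ ^ 2 * (meanWeight c (y n ω) / u (n + 1) ω) ∂P ≤
      ∫ ω, (∑ i, inner ℝ (w i (y n ω)) (y n ω - θs) / u (n + 1) ω) / N ∂P := by
    rw [← integral_const_mul]
    refine integral_mono_ae (hJ.const_mul _)
      ((integrable_finsetSum _ fun i _ => hI i).div_const _) ?_
    filter_upwards [S.mem n, S.normalizer_mem W (n + 1)] with ω hω hu
    have hu0 : 0 < u (n + 1) ω := W.pos_m.trans_le hu.1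
    have h1 := div_le_div_of_nonneg_right (W.le_inner _ hω) hu0.le
    rw [← Finset.sum_div, div_right_comm]
    calc _ = _ := by ring
      _ ≤ _ := h1
  rw [← hG.2] at hsum
  have hdiff : Integrable (fun ω => ‖y n ω - θs‖ ^ 2
      - 2 * α n * (inner ℝ (w (ζ n ω) (y n ω)) (y n ω - θs) / u (n + 1) ω)) P :=
    (S.integrable_sq_dist W n).sub (hG.1.const_mul _)
  have hle : ∫ ω, ‖y (n + 1) ω - θs‖ ^ 2 ∂P ≤ ∫ ω, (‖y n ω - θs‖ ^ 2
      - 2 * α n * (inner ℝ (w (ζ n ω) (y n ω)) (y n ω - θs) / u (n + 1) ω)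
      + (α n * B * Real.exp (t * Δ)) ^ 2) ∂P := by
    refine integral_mono_ae (S.integrable_sq_dist W (n + 1))
      (hdiff.add (integrable_const _)) ?_
    filter_upwards [S.norm_step_le W n] with ω hω
    have hx : y (n + 1) ω - θs = (y n ω - θs) - (α n / u (n + 1) ω) • w (ζ n ω) (y n ω) := by
      rw [S.param_succ]; abel
    rw [hx, norm_sub_sq_real, inner_smul_right, real_inner_comm]
    have h1 := pow_le_pow_left₀ (norm_nonneg _) hω 2
    have h2 : 2 * (α n / u (n + 1) ω * inner ℝ (w (ζ n ω) (y n ω)) (y n ω - θs)) =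
      2 * α n * (inner ℝ (w (ζ n ω) (y n ω)) (y n ω - θs) / u (n + 1) ω) := by ring
    rw [h2]
    linarith
  refine hle.trans ?_
  rw [integral_add hdiff (integrable_const _),
    integral_sub (S.integrable_sq_dist W n) (hG.1.const_mul _), integral_const_mul]
  simp only [integral_const, probReal_univ, one_smul]
  have := mul_le_mul_of_nonneg_left hsum (by positivity : 0 ≤ 2 * α n)
  linarith

theorem sq_norm_le_of_norm_sub_le {E : Type*} [NormedAddCommGroup E] {a b : E} {δ : ℝ}
    (h : ‖a - b‖ ≤ δ) : ‖a‖ ^ 2 ≤ 5 / 4 * ‖b‖ ^ 2 + 5 * δ ^ 2 := by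
  have h1 : ‖a‖ ≤ ‖b‖ + δ := by linarith [norm_le_norm_add_norm_sub' a b]
  have h2 := pow_le_pow_left₀ (norm_nonneg a) h1 2
  nlinarith [sq_nonneg (‖b‖ / 2 - 2 * δ)]

set_option maxHeartbeats 400000 in
theorem descentBounds (S : SolverProcess P Θ c w α y u ζ ξ)
    (W : WeightBounds Θ θs c w m t B μ Δ) :
    DescentBounds (fun n => ∫ ω, ‖y n ω - θs‖ ^ 2 ∂P)
      (fun n => relWeight P θs c (y n) (u (n + 1))) α t B μ Δ := by
  have hD : ∀ n, 0 ≤ ∫ ω, ‖y n ω - θs‖ ^ 2 ∂P := fun n => integral_nonneg fun ω => by positivity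
  have hJ := S.integrable_sq_dist_mul_div W
  have hconst : ∀ n C, (∀ θ ∈ Θ, ‖θ - θs‖ ^ 2 ≤ C) → ∫ ω, ‖y n ω - θs‖ ^ 2 ∂P ≤ C := by
    intro n C hC
    refine (integral_mono_ae (S.integrable_sq_dist W n) (integrable_const C) ?_).trans_eq (by simp)
    filter_upwards [S.mem n] with ω hω using hC _ hω
  have hstep : ∀ n δ, α n * B * Real.exp (t * Δ) ≤ δ → ∀ᵐ ω ∂P, ‖y (n + 1) ω - y n ω‖ ≤ δ := by
    intro n δ hδ
    filter_upwards [S.norm_step_le W n] with ω hω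
    rw [S.param_succ, sub_sub_cancel_left, norm_neg]
    exact hω.trans hδ
  obtain ⟨hκ0, hκ1⟩ := one_div_two_exp_one_mem
  refine ⟨W.pos_t, W.pos_mu, W.nonneg_B, hD, fun n => hconst n _ W.sq_dist_le_sq_div,
    fun n => hconst n _ W.sq_dist_le_range_div, ?_, ?_, ?_, ?_, ?_, ?_, ?_⟩
  · intro n hP
    refine (S.integral_sq_dist_succ_le W n).trans ?_
    have hμ := W.pos_mu
    have hα := S.nonneg_step n
    set κ := 1 / (2 * Real.exp 1) with hκ
    have hlow : 2 * κ * ∫ ω, ‖y n ω - θs‖ ^ 2 ∂P - κ ^ 2 * relWeight P θs c (y n) (u (n + 1)) ≤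
        ∫ ω, ‖y n ω - θs‖ ^ 2 * (meanWeight c (y n ω) / u (n + 1) ω) ∂P := by
      rw [relWeight, ← integral_const_mul, ← integral_const_mul, ← integral_sub
        ((S.integrable_sq_dist W n).const_mul _) ((S.integrable_relWeight W n _).const_mul _)]
      refine integral_mono_ae (((S.integrable_sq_dist W n).const_mul _).sub
        ((S.integrable_relWeight W n _).const_mul _)) (hJ n) ?_
      filter_upwards [S.mem n, S.normalizer_mem W (n + 1)] with ω hω hu
      have hu0 : 0 < u (n + 1) ω := W.pos_m.trans_le hu.1
      have hp : 0 < meanWeight c (y n ω) := W.pos_m.trans_le (W.le_meanWeight hω)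
      set a := meanWeight c (y n ω)
      set v := u (n + 1) ω
      -- This is (a - κv)² ≥ 0. It trades the reciprocal of the estimate for an expression linear in
      -- it, whose mean is computable.
      have key : 2 * κ - κ ^ 2 * (v / a) ≤ a / v := by
        have : a / v - (2 * κ - κ ^ 2 * (v / a)) = (a - κ * v) ^ 2 / (a * v) := by
          field_simp; ring
        have : 0 ≤ (a - κ * v) ^ 2 / (a * v) := by positivity
        linarith
      have := mul_le_mul_of_nonneg_left key (sq_nonneg ‖y n ω - θs‖)
      linarith
    have h1 : κ ^ 2 * relWeight P θs c (y n) (u (n + 1)) ≤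
        κ ^ 2 * (2 * Real.exp 1 * ∫ ω, ‖y n ω - θs‖ ^ 2 ∂P) := by gcongr
    have h2 : κ ^ 2 * (2 * Real.exp 1 * ∫ ω, ‖y n ω - θs‖ ^ 2 ∂P) =
        κ * ∫ ω, ‖y n ω - θs‖ ^ 2 ∂P := by rw [hκ]; field_simp
    have h3 : κ * ∫ ω, ‖y n ω - θs‖ ^ 2 ∂P ≤
      ∫ ω, ‖y n ω - θs‖ ^ 2 * (meanWeight c (y n ω) / u (n + 1) ω) ∂P := by linarith
    have h4 := mul_le_mul_of_nonneg_left h3 (by positivity : 0 ≤ 2 * α n * μ)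
    have h5 : 2 * α n * μ * (κ * ∫ ω, ‖y n ω - θs‖ ^ 2 ∂P) =
        α n * μ / Real.exp 1 * ∫ ω, ‖y n ω - θs‖ ^ 2 ∂P := by rw [hκ]; field_simp
    linarith
  · intro n
    refine (S.integral_sq_dist_succ_le W n).trans ?_
    have hμ := W.pos_mu
    have hα := S.nonneg_step n
    have : 0 ≤ ∫ ω, ‖y n ω - θs‖ ^ 2 * (meanWeight c (y n ω) / u (n + 1) ω) ∂P := by
      refine integral_nonneg_of_ae ?_
      filter_upwards [S.meanWeight_div_mem W n (n + 1)] with ω h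
      exact mul_nonneg (sq_nonneg _) h.1
    have := mul_nonneg (by positivity : 0 ≤ 2 * α n * μ) this
    linarith
  · intro n
    rw [relWeight, ← integral_const_mul]
    refine integral_mono_ae (S.integrable_relWeight W n _)
      ((S.integrable_sq_dist W n).const_mul _) ?_
    filter_upwards [S.div_meanWeight_mem W n (n + 1)] with ω h
    rw [mul_comm]
    exact mul_le_mul_of_nonneg_right h.2 (sq_nonneg _)
  · have h0 : relWeight P θs c (y 0) (u 0) = ∫ ω, ‖y 0 ω - θs‖ ^ 2 ∂P := by
      refine integral_congr_ae ?_
      filter_upwards [S.mem 0] with ω hω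
      have hp : 0 < meanWeight c (y 0 ω) := W.pos_m.trans_le (W.le_meanWeight hω)
      rw [S.normalizer_zero, div_self hp.ne', mul_one]
    rw [S.relWeight_succ_eq W 0, h0]
    linarith
  · intro n
    refine integral_nonneg_of_ae ?_
    filter_upwards [S.div_meanWeight_mem W n (n + 1)] with ω h
    exact mul_nonneg (sq_nonneg _) h.1
  · intro n δ hδ hδ'
    rw [S.relWeight_succ_eq W (n + 1)]
    have hle : relWeight P θs c (y (n + 1)) (u (n + 1)) ≤
        4 / 3 * (5 / 4 * relWeight P θs c (y n) (u (n + 1)) + 5 * Real.exp (t * Δ) * δ ^ 2) := by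
      have hi := ((S.integrable_relWeight W n (n + 1)).const_mul (5 / 4)).add
        (integrable_const (5 * Real.exp (t * Δ) * δ ^ 2))
      refine (integral_mono_ae (S.integrable_relWeight W (n + 1) (n + 1)) (hi.const_mul (4 / 3))
        ?_).trans_eq ?_
      · filter_upwards [S.mem n, S.mem (n + 1), S.normalizer_mem W (n + 1), hstep n δ hδ,
          S.div_meanWeight_mem W n (n + 1)] with ω hω hω' hu hs hr
        have hu0 : 0 < u (n + 1) ω := W.pos_m.trans_le hu.1
        have hp : 0 < meanWeight c (y n ω) := W.pos_m.trans_le (W.le_meanWeight hω)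
        have hp' : 0 < meanWeight c (y (n + 1) ω) := W.pos_m.trans_le (W.le_meanWeight hω')
        have h1 : ‖y (n + 1) ω - θs‖ ^ 2 ≤ 5 / 4 * ‖y n ω - θs‖ ^ 2 + 5 * δ ^ 2 :=
          sq_norm_le_of_norm_sub_le (by rwa [sub_sub_sub_cancel_right])
        have h2 : meanWeight c (y n ω) ≤ 4 / 3 * meanWeight c (y (n + 1) ω) := by
          refine (W.meanWeight_le _ hω _ hω').trans ?_
          gcongr
          have h3 : t * B * ‖y n ω - y (n + 1) ω‖ ≤ 1 / 4 := by
            rw [norm_sub_rev]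
            have := mul_nonneg W.pos_t.le W.nonneg_B
            exact (mul_le_mul_of_nonneg_left hs this).trans hδ'
          refine (Real.exp_le_exp.2 h3).trans ?_
          -- From 3/4 ≤ e^{-1/4} follows e^{1/4} ≤ 4/3.
          have h4 := Real.add_one_le_exp (-(1 / 4) : ℝ)
          rw [Real.exp_neg, ← one_div, le_div_iff₀ (Real.exp_pos _)] at h4
          linarith
        have h3 : u (n + 1) ω / meanWeight c (y (n + 1) ω) ≤
            4 / 3 * (u (n + 1) ω / meanWeight c (y n ω)) := by
          rw [mul_div_assoc', div_le_div_iff₀ hp' hp]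
          nlinarith
        have h4 : 0 ≤ u (n + 1) ω / meanWeight c (y (n + 1) ω) := by positivity
        set q := u (n + 1) ω / meanWeight c (y n ω)
        simp only [Pi.add_apply]
        calc _ ≤ (5 / 4 * ‖y n ω - θs‖ ^ 2 + 5 * δ ^ 2) * (4 / 3 * q) := by gcongr
          _ = 4 / 3 * (5 / 4 * (‖y n ω - θs‖ ^ 2 * q) + 5 * q * δ ^ 2) := by ring
          _ ≤ _ := by gcongr; exact hr.2
      · rw [integral_const_mul]
        simp only [Pi.add_apply]
        rw [integral_add ((S.integrable_relWeight W n (n + 1)).const_mul (5 / 4))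
          (integrable_const _), integral_const_mul]
        simp [relWeight]
    have h1 := mul_le_mul_of_nonneg_left hle hκ0.le
    have h2 := mul_nonneg hκ0.le (hD (n + 1))
    linarith
  · intro n δ hδ
    have hi := ((S.integrable_sq_dist W (n + 1)).const_mul (5 / 4)).add
      (integrable_const (5 * δ ^ 2))
    refine (integral_mono_ae (S.integrable_sq_dist W n) hi ?_).trans_eq ?_
    · filter_upwards [hstep n δ hδ] with ω hs
      exact sq_norm_le_of_norm_sub_le (by rwa [sub_sub_sub_cancel_right, norm_sub_rev])
    · simp only [Pi.add_apply]
      rw [integral_add ((S.integrable_sq_dist W (n + 1)).const_mul (5 / 4)) (integrable_const _),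
        integral_const_mul]
      simp

end SolverProcess

/-! ### Realizing the solver as a measurable function of its randomness. -/

/-- The parameter and the exponentiated normalizer estimate after `n` iterations, as a function of
the initial parameter and of all the samples. -/
noncomputable def weightPath (c : Fin N → EuclideanSpace ℝ (Fin d) → ℝ)
    (w : Fin N → EuclideanSpace ℝ (Fin d) → EuclideanSpace ℝ (Fin d)) (α : ℕ → ℝ) :
    ℕ → EuclideanSpace ℝ (Fin d) × (ℕ ⊕ ℕ → Fin N) → EuclideanSpace ℝ (Fin d) × ℝ
  | 0, p => (p.1, meanWeight c p.1)
  | n + 1, p =>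
    let s := weightPath c w α n p
    let v := 1 / (2 * Real.exp 1) * s.2 +
      (1 - 1 / (2 * Real.exp 1)) * c (p.2 (Sum.inr (n + 1))) s.1
    (s.1 - (α (n + 1) / v) • w (p.2 (Sum.inl (n + 1))) s.1, v)

section WeightPath

variable {c : Fin N → EuclideanSpace ℝ (Fin d) → ℝ}
  {w : Fin N → EuclideanSpace ℝ (Fin d) → EuclideanSpace ℝ (Fin d)} {α : ℕ → ℝ}

theorem measurable_apply_sample {E F : Type*} [MeasurableSpace E] [MeasurableSpace F]
    {g : Fin N → E → F} (hg : ∀ i, Measurable (g i))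
    {j : Ω → Fin N} {z : Ω → E} (hj : Measurable j) (hz : Measurable z) :
    Measurable fun ω => g (j ω) (z ω) := by
  have h : Measurable fun q : E × Fin N => g q.2 q.1 := measurable_from_prod_countable_left hg
  exact h.comp (hz.prodMk hj)

theorem measurable_weightPath (hc : ∀ i, Measurable (c i)) (hw : ∀ i, Measurable (w i)) (n : ℕ) :
    Measurable (weightPath c w α n) := by
  induction n with
  | zero =>
    exact measurable_fst.prodMk
      (((Finset.measurable_fun_sum _ fun i _ => hc i).div_const _).comp measurable_fst)
  | succ n ih =>
    have hz : ∀ j, Measurable fun p : EuclideanSpace ℝ (Fin d) × (ℕ ⊕ ℕ → Fin N) => p.2 j :=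
      fun j => (measurable_pi_apply j).comp measurable_snd
    have hv : Measurable fun p => 1 / (2 * Real.exp 1) * (weightPath c w α n p).2 +
        (1 - 1 / (2 * Real.exp 1)) * c (p.2 (Sum.inr (n + 1))) (weightPath c w α n p).1 :=
      (ih.snd.const_mul _).add ((measurable_apply_sample hc (hz _) ih.fst).const_mul _)
    exact (ih.fst.sub ((measurable_const.div hv).smul
      (measurable_apply_sample hw (hz _) ih.fst))).prodMk hv

theorem weightPath_congr (n : ℕ) (θ : EuclideanSpace ℝ (Fin d)) (z z' : ℕ ⊕ ℕ → Fin N)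
    (h : ∀ j ≤ n, z (Sum.inl j) = z' (Sum.inl j) ∧ z (Sum.inr j) = z' (Sum.inr j)) :
    weightPath c w α n (θ, z) = weightPath c w α n (θ, z') := by
  induction n with
  | zero => rfl
  | succ n ih =>
    simp only [weightPath, ih fun j hj => h j (by omega), (h (n + 1) le_rfl).1,
      (h (n + 1) le_rfl).2]

theorem weightPath_succ_snd_congr (n : ℕ) (θ : EuclideanSpace ℝ (Fin d)) (z z' : ℕ ⊕ ℕ → Fin N)
    (h : ∀ j ≤ n, z (Sum.inl j) = z' (Sum.inl j) ∧ z (Sum.inr j) = z' (Sum.inr j))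
    (h' : z (Sum.inr (n + 1)) = z' (Sum.inr (n + 1))) :
    (weightPath c w α (n + 1) (θ, z)).2 = (weightPath c w α (n + 1) (θ, z')).2 := by
  simp only [weightPath, weightPath_congr n θ z z' h, h']

variable [NeZero N] {P : Measure Ω} [IsProbabilityMeasure P]

theorem solverProcess_weightPath {Θ : Set (EuclideanSpace ℝ (Fin d))}
    (hc : ∀ i, Measurable (c i)) (hw : ∀ i, Measurable (w i)) (hα : ∀ n, 0 ≤ α n)
    {θ₁ : Ω → EuclideanSpace ℝ (Fin d)} (hθ₁ : Measurable θ₁) {ζ ξ : ℕ → Ω → Fin N}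
    (hζ : ∀ k, Measurable (ζ k)) (hξ : ∀ k, Measurable (ξ k))
    (hζu : ∀ k, P.map (ζ k) = (PMF.uniformOfFintype (Fin N)).toMeasure)
    (hξu : ∀ k, P.map (ξ k) = (PMF.uniformOfFintype (Fin N)).toMeasure)
    (hind : iIndepFun (Sum.elim ζ ξ) P)
    (hind₁ : IndepFun θ₁ (fun ω (j : ℕ ⊕ ℕ) => Sum.elim ζ ξ j ω) P)
    (hmem : ∀ n, ∀ᵐ ω ∂P, (weightPath c w α n (θ₁ ω, fun j => Sum.elim ζ ξ j ω)).1 ∈ Θ) :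
    SolverProcess P Θ c w (fun n => α (n + 1))
      (fun n ω => (weightPath c w α n (θ₁ ω, fun j => Sum.elim ζ ξ j ω)).1)
      (fun n ω => (weightPath c w α n (θ₁ ω, fun j => Sum.elim ζ ξ j ω)).2)
      (fun n => ζ (n + 1)) (fun n => ξ (n + 1)) := by
  classical
  have hZ : ∀ j, Measurable (Sum.elim ζ ξ j) := by rintro (j | j); exacts [hζ j, hξ j]
  have hp : Measurable fun ω => (θ₁ ω, fun j => Sum.elim ζ ξ j ω) :=
    hθ₁.prodMk (measurable_pi_lambda _ hZ)
  have hpath := measurable_weightPath (α := α) hc hw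
  let past : ℕ → Finset (ℕ ⊕ ℕ) := fun n =>
    (Finset.range (n + 1)).disjSum (Finset.range (n + 1))
  refine ⟨fun n => hα _, fun n => (hpath n).fst.comp hp, fun n => (hpath n).snd.comp hp,
    fun n => hζ _, fun n => hξ _, fun n => hζu _, fun n => hξu _, fun n => ?_, fun n => ?_,
    fun _ => rfl, fun _ _ => rfl, fun _ _ => rfl, hmem⟩
  -- The normalizer used in this step has already seen the current ξ, so that sample joins the past;
  -- the current ζ does not.
  · refine indepFun_of_eq_of_forall_mem hθ₁ hZ hind hind₁ (j₀ := Sum.inl (n + 1))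
      (S := insert (Sum.inr (n + 1)) (past n)) (by simp [past])
      (G := fun p => ((weightPath c w α n p).1, (weightPath c w α (n + 1) p).2))
      ((hpath n).fst.prodMk (hpath (n + 1)).snd) fun a z z' h => ?_
    have h' : ∀ j ≤ n, z (Sum.inl j) = z' (Sum.inl j) ∧ z (Sum.inr j) = z' (Sum.inr j) :=
      fun j hj => ⟨h _ (by simp [past]; omega), h _ (by simp [past]; omega)⟩
    rw [weightPath_congr n a z z' h', weightPath_succ_snd_congr n a z z' h' (h _ (by simp))]
  · refine indepFun_of_eq_of_forall_mem hθ₁ hZ hind hind₁ (j₀ := Sum.inr (n + 1))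
      (S := past n) (by simp [past]) (G := weightPath c w α n) (hpath n) fun a z z' h => ?_
    exact weightPath_congr n a z z' fun j hj =>
      ⟨h _ (by simp [past]; omega), h _ (by simp [past]; omega)⟩

end WeightPath

/-- The cut-off weights give measurability without any regularity of the loss outside Θ, and nothing
changes along a run that stays in Θ. -/
theorem solverState_eq_weightPath {𝒳 : Type*} [NeZero N]
    {f : 𝒳 → EuclideanSpace ℝ (Fin d) → ℝ} {x : Fin N → 𝒳} {t : ℝ} (ht : 0 < t)
    {Θ : Set (EuclideanSpace ℝ (Fin d))} {α : ℕ → ℝ} {ζ ξ : ℕ → Fin N}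
    {θ₁ : EuclideanSpace ℝ (Fin d)}
    (hmem : ∀ n, (solverState f x t avgParam α (fun k => {ζ k}) (fun k => {ξ k}) θ₁ n).1 ∈ Θ)
    (n : ℕ) :
    weightPath (cutWeight f x t Θ) (cutGrad f x t Θ) α n (θ₁, Sum.elim ζ ξ) =
      ((solverState f x t avgParam α (fun k => {ζ k}) (fun k => {ξ k}) θ₁ n).1,
        Real.exp (t * (solverState f x t avgParam α (fun k => {ζ k}) (fun k => {ξ k}) θ₁ n).2)) := by
  induction n with
  | zero =>
    have h : θ₁ ∈ Θ := hmem 0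
    simp only [weightPath, solverState, meanWeight, exp_mul_tiltedLoss ht, cutWeight,
      Set.indicator_of_mem h]
  | succ n ih =>
    have h := hmem n
    simp only [weightPath, ih, solverState, updateParam, updateNormalizer]
    set s := solverState f x t avgParam α (fun k => {ζ k}) (fun k => {ξ k}) θ₁ n
    obtain ⟨hκ0, hκ1⟩ := one_div_two_exp_one_mem
    simp only [Sum.elim_inl, Sum.elim_inr, cutWeight, cutGrad, Set.indicator_of_mem h, avgParam,
      sub_sub_cancel, Finset.sum_singleton, Finset.card_singleton, Nat.cast_one, div_one,
      exp_mul_tiltedLossOn ht (Finset.singleton_nonempty _)]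
    set κ := 1 / (2 * Real.exp 1)
    have hv : 0 < κ * Real.exp (t * s.2) + (1 - κ) * Real.exp (t * f (x (ξ (n + 1))) s.1) :=
      add_pos (mul_pos hκ0 (Real.exp_pos _)) (mul_pos (sub_pos.2 hκ1) (Real.exp_pos _))
    have hlog : t * (1 / t * Real.log (κ * Real.exp (t * s.2)
        + (1 - κ) * Real.exp (t * f (x (ξ (n + 1))) s.1))) = Real.log (κ * Real.exp (t * s.2)
        + (1 - κ) * Real.exp (t * f (x (ξ (n + 1))) s.1)) := by field_simp
    rw [hlog, Real.exp_sub, Real.exp_log hv, smul_smul, smul_smul]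
    congr 3
    ring

/-! ### Step sizes at the end of the burn-in. -/

theorem one_le_burnIn (t L B μ Fmin Fmax : ℝ) : 1 ≤ burnIn t L B μ Fmin Fmax := le_max_left _ _

/-- With C = tLBe^{t(Fmax-Fmin)}, the inequality defining the burn-in and k ≥ 1 give μk ≤ 2e + eC ≤
2e(1 + C). -/
theorem stepSize_burnIn_le {t L B μ Fmin Fmax : ℝ} (ht : 0 < t) (hL : 0 ≤ L) (hB : 0 ≤ B)
    (hμ : 0 < μ) (h1 : 1 < burnIn t L B μ Fmin Fmax) :
    1 / (t * L * B * Real.exp (t * (Fmax - Fmin)) + 1) ≤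
      2 * Real.exp 1 / (μ * burnIn t L B μ Fmin Fmax) := by
  set A := {k : ℕ | 1 ≤ k ∧ (k : ℝ) < 2 * Real.exp 1 / μ
    + Real.exp 1 * t * L * B * Real.exp (t * (Fmax - Fmin)) / (μ * k)} with hA
  have hk : burnIn t L B μ Fmin Fmax = sSup A := by
    rw [burnIn] at h1 ⊢
    exact max_eq_right ((lt_max_iff.1 h1).resolve_left (lt_irrefl _)).le
  -- The supremum of the empty set is 0 in ℕ, which would make the burn-in equal to 1.
  have hne : A.Nonempty := by
    by_contra h
    rw [Set.not_nonempty_iff_eq_empty] at h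
    rw [hk, h] at h1
    simp at h1
  have hbdd : BddAbove A := by
    refine ⟨⌈2 * Real.exp 1 / μ + Real.exp 1 * t * L * B * Real.exp (t * (Fmax - Fmin)) / μ⌉₊, ?_⟩
    rintro k ⟨hk1, hk2⟩
    have hk1' : (1 : ℝ) ≤ k := by exact_mod_cast hk1
    have : (k : ℝ) ≤ 2 * Real.exp 1 / μ
        + Real.exp 1 * t * L * B * Real.exp (t * (Fmax - Fmin)) / μ := by
      refine hk2.le.trans ?_
      gcongr
      exact le_mul_of_one_le_right hμ.le hk1'
    exact_mod_cast this.trans (Nat.le_ceil _)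
  obtain ⟨hk1, hk2⟩ := Nat.sSup_mem hne hbdd
  rw [← hk] at hk1 hk2
  set k := burnIn t L B μ Fmin Fmax
  have hk1' : (1 : ℝ) ≤ k := by exact_mod_cast hk1
  set C := t * L * B * Real.exp (t * (Fmax - Fmin)) with hC
  have hC0 : 0 ≤ C := by positivity
  have he := Real.exp_pos 1
  have hk3 : (k : ℝ) * μ ≤ 2 * Real.exp 1 + Real.exp 1 * C := by
    have h2 : Real.exp 1 * t * L * B * Real.exp (t * (Fmax - Fmin)) / (μ * k) ≤
        Real.exp 1 * C / μ := by
      have : Real.exp 1 * t * L * B * Real.exp (t * (Fmax - Fmin)) = Real.exp 1 * C := by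
        rw [hC]; ring
      rw [this]
      gcongr
      exact le_mul_of_one_le_right hμ.le hk1'
    have h3 := hk2.le.trans (add_le_add_right h2 _)
    rwa [← add_div, le_div_iff₀ hμ] at h3
  rw [div_le_div_iff₀ (by positivity) (by positivity)]
  nlinarith [mul_nonneg he.le hC0]

end TERM

theorem mainTheorem9 {𝒳 : Type*} {d N : ℕ} [NeZero N]
    -- data, loss, open parameter domain, tilt
    (x : Fin N → 𝒳) (f : 𝒳 → EuclideanSpace ℝ (Fin d) → ℝ)
    (Θ : Set (EuclideanSpace ℝ (Fin d))) (hΘ : IsOpen Θ)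
    (t : ℝ) (ht : 0 < t)
    (hf : ∀ i, ContDiffOn ℝ 1 (f (x i)) Θ)
    -- bounded `L`-Lipschitz losses
    (Fmin Fmax : ℝ) (hF : ∀ a, ∀ θ ∈ Θ, f a θ ∈ Set.Icc Fmin Fmax)
    (L : ℝ) (hL0 : 0 ≤ L)
    (hL : ∀ a, ∀ θ ∈ Θ, ∀ θ' ∈ Θ, |f a θ - f a θ'| ≤ L * ‖θ - θ'‖)
    -- strongly convex tilted objective with minimizer `θstar`
    (μ : ℝ) (hμ : 0 < μ) (hsc : StrongConvexOn Θ μ (TERM.tiltedLoss f x t))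
    (θstar : EuclideanSpace ℝ (Fin d)) (hstarΘ : θstar ∈ Θ)
    (hstar : IsMinOn (TERM.tiltedLoss f x t) Θ θstar)
    -- bounded stochastic gradients
    (B : ℝ) (hB : ∀ i, ∀ θ ∈ Θ, ‖TERM.tiltedStochGrad f x t i θ‖ ≤ B)
    -- initial parameter and independent uniform samples
    {Ω : Type*} [MeasurableSpace Ω] (P : Measure Ω) [IsProbabilityMeasure P]
    (θ₁ : Ω → EuclideanSpace ℝ (Fin d)) (hθ₁ : Measurable θ₁)
    (ζ ξ : ℕ → Ω → Fin N) (hζ : ∀ k, Measurable (ζ k)) (hξ : ∀ k, Measurable (ξ k))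
    (hζu : ∀ k, P.map (ζ k) = (PMF.uniformOfFintype (Fin N)).toMeasure)
    (hξu : ∀ k, P.map (ξ k) = (PMF.uniformOfFintype (Fin N)).toMeasure)
    (hind : iIndepFun (fun j : ℕ ⊕ ℕ => Sum.elim ζ ξ j) P)
    (hind₁ : IndepFun θ₁ (fun ω (j : ℕ ⊕ ℕ) => Sum.elim ζ ξ j ω) P)
    -- the iterates, which stay in the parameter domain
    (θ : ℕ → Ω → EuclideanSpace ℝ (Fin d))
    (hθ : ∀ k ω, θ k ω = TERM.termIterate f x t L B μ Fmin Fmax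
      (fun j => ζ j ω) (fun j => ξ j ω) (θ₁ ω) k)
    (hθΘ : ∀ᵐ ω ∂P, ∀ k, 1 ≤ k → θ k ω ∈ Θ)
    (kt : ℕ) (hkt : kt = TERM.burnIn t L B μ Fmin Fmax)
    (Vt : ℝ) (hVt : Vt = max (kt * ∫ ω, ‖θ kt ω - θstar‖ ^ 2 ∂P)
      (4 * B ^ 2 * Real.exp (2 + 2 * t * (Fmax - Fmin)) / μ ^ 2)) :
    (∀ k, 1 ≤ k → Integrable (fun ω => ‖θ k ω - θstar‖ ^ 2) P) ∧
    (∀ k, kt ≤ k → ∫ ω, ‖θ (k + 1) ω - θstar‖ ^ 2 ∂P ≤ Vt / (k + 1)) ∧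
    ∫ ω, ‖θ kt ω - θstar‖ ^ 2 ∂P ≤
      max (∫ ω, ‖θ 1 ω - θstar‖ ^ 2 ∂P)
        (B ^ 2 * Real.exp (2 * t * (Fmax - Fmin) + 1)
          / (μ * (1 + t * L * B * Real.exp (t * (Fmax - Fmin))))) := by
  have W := TERM.weightBounds_of_strongConvexOn hΘ ht hf (fun i => hF (x i)) hμ hsc hstarΘ hstar hB
  have hB0 := W.nonneg_B
  set c := TERM.cutWeight f x t Θ
  set w := TERM.cutGrad f x t Θ
  set α := TERM.stepSize t L B μ Fmin Fmax with hαd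
  -- Indices start at 0 here: y n is almost surely θ (n + 1), the step from y n is α (n + 1), and kt
  -- = K + 1 corresponds to time K.
  let y : ℕ → Ω → EuclideanSpace ℝ (Fin d) := fun n ω =>
    (TERM.weightPath c w α n (θ₁ ω, fun j => Sum.elim ζ ξ j ω)).1
  have hyθ : ∀ n, ∀ᵐ ω ∂P, y n ω = θ (n + 1) ω := by
    intro n
    filter_upwards [hθΘ] with ω hω
    have hst : ∀ n, (TERM.solverState f x t TERM.avgParam α (fun k => {ζ k ω})
        (fun k => {ξ k ω}) (θ₁ ω) n).1 = θ (n + 1) ω := fun n => (hθ (n + 1) ω).symm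
    have hz : (fun j => Sum.elim ζ ξ j ω) = Sum.elim (fun j => ζ j ω) (fun j => ξ j ω) := by
      funext j; cases j <;> rfl
    change (TERM.weightPath c w α n (θ₁ ω, fun j => Sum.elim ζ ξ j ω)).1 = _
    rw [hz, TERM.solverState_eq_weightPath ht
      (fun n => by rw [hst]; exact hω (n + 1) (by omega)), hst]
  have hα0 : ∀ n, 0 ≤ α n := by
    intro n
    rw [hαd, TERM.stepSize]
    split_ifs <;> positivity
  have S := TERM.solverProcess_weightPath (Θ := Θ) W.measurable_weight W.measurable_grad hα0 hθ₁
    hζ hξ hζu hξu hind hind₁ (fun n => by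
      filter_upwards [hyθ n, hθΘ] with ω h1 h2
      exact (show y n ω ∈ Θ from h1 ▸ h2 (n + 1) (by omega)))
  have hsq : ∀ n, (fun ω => ‖y n ω - θstar‖ ^ 2) =ᵐ[P] fun ω => ‖θ (n + 1) ω - θstar‖ ^ 2 :=
    fun n => by filter_upwards [hyθ n] with ω h; rw [h]
  have hDeq : ∀ n, ∫ ω, ‖y n ω - θstar‖ ^ 2 ∂P = ∫ ω, ‖θ (n + 1) ω - θstar‖ ^ 2 ∂P :=
    fun n => integral_congr_ae (hsq n)
  have H := S.descentBounds W
  obtain ⟨K, rfl⟩ : ∃ K, kt = K + 1 :=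
    ⟨kt - 1, by have := TERM.one_le_burnIn t L B μ Fmin Fmax; omega⟩
  have hpre : ∀ n < K, α (n + 1) = 1 / (t * L * B * Real.exp (t * (Fmax - Fmin)) + 1) :=
    fun n hn => by rw [hαd, TERM.stepSize, if_pos (by omega)]
  have hpost : ∀ n, K ≤ n → α (n + 1) = 2 * Real.exp 1 / (μ * (n + 1)) :=
    fun n hn => by rw [hαd, TERM.stepSize, if_neg (by omega)]; push_cast; rfl
  refine ⟨fun k hk => ?_, fun k hk => ?_, ?_⟩
  · obtain ⟨n, rfl⟩ : ∃ n, k = n + 1 := ⟨k - 1, by omega⟩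
    exact (S.integrable_sq_dist W n).congr (hsq n)
  · have hV := H.le_div_of_harmonic_step (K := K) hpost (fun n hn => by
      rw [hpre n hn]
      have := TERM.stepSize_burnIn_le (Fmin := Fmin) (Fmax := Fmax) ht hL0 hB0 hμ
        (by rw [← hkt]; omega)
      rw [← hkt] at this
      exact_mod_cast this) (V := Vt)
      (by
        rw [hVt]
        refine le_trans (le_of_eq ?_) (le_max_left _ _)
        rw [← hDeq K]; push_cast; rfl)
      (by
        rw [hVt]
        refine le_trans (le_of_eq ?_) (le_max_right _ _)
        have : Real.exp (2 + 2 * t * (Fmax - Fmin)) =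
            Real.exp 1 ^ 2 * Real.exp (t * (Fmax - Fmin)) ^ 2 := by
          rw [← Real.exp_nat_mul, ← Real.exp_nat_mul, ← Real.exp_add]
          congr 1; push_cast; ring
        rw [this]; ring)
      k (by omega)
    rw [← hDeq k]
    exact hV
  · have hM := H.le_max_of_const_step (K := K) (by positivity) hpre K le_rfl
    rw [← hDeq K, ← hDeq 0]
    refine hM.trans (le_of_eq ?_)
    congr 1
    have : Real.exp (2 * t * (Fmax - Fmin) + 1) =
        Real.exp (t * (Fmax - Fmin)) ^ 2 * Real.exp 1 := by
      rw [← Real.exp_nat_mul, ← Real.exp_add]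
      congr 1; push_cast; ring
    rw [this, add_comm (t * L * B * Real.exp (t * (Fmax - Fmin))) 1, mul_one_div, div_div]
    ring
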